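/- Let $M(2)=\mathbb{R}^2\ltimes SO(2)$, with $SO(2)$ identified with the unit circle $S^1$, be the group with the law $(x,e^{i\alpha})(y,e^{i\beta})=(x+e^{i\alpha}y,\,e^{i(\alpha+\beta)})$, where $e^{i\alpha}$ acts on $\mathbb{R}^2$ as the rotation by $\alpha$. Let $dg=dx\,\frac{d\alpha}{2\pi}$ be its Haar measure, $L^2(M(2))=L^2(M(2),dg)$, and $(f*k)(g)=\int_{M(2)}f(h)\,k(h^{-1}g)\,dh$ the group convolution. For $t>0$ let $$\psi_t(x,e^{i\alpha})=\frac{1}{4\pi t}\,e^{-|x|^2/4t}\sum_{n\in\mathbb{Z}}e^{-n^2t}e^{in\alpha}$$ be the heat kernel of $M(2)$. Regard $M(2)=\mathbb{R}^2\times S^1$ as a subset of $\mathbb{C}^2\times\mathbb{C}^*$, where $\mathbb{C}^*=\mathbb{C}\setminus\{0\}$. Let $\mathcal{H}_t(\mathbb{C}^2\times\mathbb{C}^*)$ be the space of the holomorphic functions on $\mathbb{C}^2\times\mathbb{C}^*$ that are square integrable with respect to $\mu\otimes\nu$, with the inner product of $L^2(\mu\otimes\nu)$, where $$d\mu(z)=\frac{1}{2\pi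 t}\,e^{-|y|^2/2t}\,dx\,dy\quad(z=x+iy\in\mathbb{C}^2),\qquad d\nu(w)=\frac{1}{2\pi}\,\frac{1}{\sqrt{2\pi t}}\,\frac{e^{-(\ln|w|)^2/2t}}{|w|^2}\,dw\quad(w\in\mathbb{C}^*),$$ and $dw$ is the Lebesgue measure on $\mathbb{C}$. **Theorem.** Let $t>0$. For every $f\in L^2(M(2))$ the integral defining $(f*\psi_t)(g)$ converges absolutely for every $g\in M(2)$, and $f*\psi_t$ extends to a unique holomorphic function on $\mathbb{C}^2\times\mathbb{C}^*$. Moreover, the map that sends $f$ to the holomorphic extension of $f*\psi_t$ is a unitary map (a surjective linear isometry) from $L^2(M(2))$ onto $\mathcal{H}_t(\mathbb{C}^2\times\mathbb{C}^*)$. -/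

import Mathlib

open MeasureTheory Set
open scoped ENNReal ComplexConjugate

noncomputable section

/-! ### The rigid motion group -/

/-- The rigid motion group `M(2) = ℝ² ⋊ SO(2)`, with `SO(2)` identified with the unit circle. -/
@[ext] structure M2 where
  /-- the translation part -/
  trans : EuclideanSpace ℝ (Fin 2)
  /-- the rotation part, `e^{iα}` -/
  rot : Circle

/-- The rotation of `ℝ²` by the angle `α`, where `u = e^{iα}`, that is,
`cos α = Re u` and `sin α = Im u`. -/
def rotate (u : Circle) (x : EuclideanSpace ℝ (Fin 2)) : EuclideanSpace ℝ (Fin 2) :=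
  !₂[(u : ℂ).re * x 0 - (u : ℂ).im * x 1, (u : ℂ).im * x 0 + (u : ℂ).re * x 1]

theorem rotate_mul (u v : Circle) (x : EuclideanSpace ℝ (Fin 2)) :
    rotate (u * v) x = rotate u (rotate v x) := by
  ext i
  fin_cases i <;> simp [rotate] <;> ring

theorem rotate_one (x : EuclideanSpace ℝ (Fin 2)) : rotate 1 x = x := by
  ext i
  fin_cases i <;> simp [rotate]

theorem rotate_add (u : Circle) (x y : EuclideanSpace ℝ (Fin 2)) :
    rotate u (x + y) = rotate u x + rotate u y := by
  ext i
  fin_cases i <;> simp [rotate] <;> ring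

theorem rotate_neg (u : Circle) (x : EuclideanSpace ℝ (Fin 2)) :
    rotate u (-x) = -rotate u x := by
  ext i
  fin_cases i <;> simp [rotate] <;> ring

/-- The group law `(x, e^{iα}) (y, e^{iβ}) = (x + e^{iα} y, e^{i(α + β)})`. -/
instance : Mul M2 := ⟨fun g h => ⟨g.trans + rotate g.rot h.trans, g.rot * h.rot⟩⟩

instance : One M2 := ⟨⟨0, 1⟩⟩

instance : Inv M2 := ⟨fun g => ⟨-rotate g.rot⁻¹ g.trans, g.rot⁻¹⟩⟩

instance : Group M2 :=
  Group.ofLeftAxioms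
    (fun a b c => M2.ext
      (show a.trans + rotate a.rot b.trans + rotate (a.rot * b.rot) c.trans
          = a.trans + rotate a.rot (b.trans + rotate b.rot c.trans) by
        rw [rotate_mul, rotate_add, add_assoc])
      (mul_assoc a.rot b.rot c.rot))
    (fun a => M2.ext
      (show 0 + rotate 1 a.trans = a.trans by rw [rotate_one, zero_add])
      (one_mul a.rot))
    (fun a => M2.ext
      (show -rotate a.rot⁻¹ a.trans + rotate a.rot⁻¹ a.trans = 0 from neg_add_cancel _)
      (inv_mul_cancel a.rot))

instance : MeasurableSpace Circle := borel Circle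

instance : BorelSpace Circle := ⟨rfl⟩

/-- The normalized arc length `dα / 2π` on the circle. -/
def circleMeasure : Measure Circle :=
  ENNReal.ofReal (1 / (2 * Real.pi)) •
    (volume.restrict (Ioc (-Real.pi) Real.pi)).map Circle.exp

/-- `M(2)` is the product `ℝ² × S¹` as a measurable space. -/
instance : MeasurableSpace M2 :=
  MeasurableSpace.comap (fun g : M2 => (g.trans, g.rot)) inferInstance

/-- The Haar measure `dx dα / 2π` of `M(2)`. -/
instance : MeasureSpace M2 :=
  ⟨((volume : Measure (EuclideanSpace ℝ (Fin 2))).prod circleMeasure).map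
    (fun p => (⟨p.1, p.2⟩ : M2))⟩

/-- The group convolution `(f * k)(g) = ∫ f(h) k(h⁻¹ g) dh` on `M(2)`. -/
def M2.conv (f k : M2 → ℂ) (g : M2) : ℂ := ∫ h : M2, f h * k (h⁻¹ * g)

/-- The heat kernel of `M(2)`,
`(x, e^{iα}) ↦ (4πt)⁻¹ e^{-|x|²/4t} ∑_{n ∈ ℤ} e^{-n²t} e^{inα}`. -/
def M2.heatKernel (t : ℝ) (g : M2) : ℂ :=
  ((1 / (4 * Real.pi * t) * Real.exp (-‖g.trans‖ ^ 2 / (4 * t)) : ℝ) : ℂ) *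
    ∑' n : ℤ, (Real.exp (-(n : ℝ) ^ 2 * t) : ℂ) * (g.rot : ℂ) ^ n

/-! ### The complexification and the weighted Bergman space -/

/-- The open subset `ℂ² × ℂ*` of `ℂ² × ℂ`. -/
def complexM2 : Set ((Fin 2 → ℂ) × ℂ) := {p | p.2 ≠ 0}

/-- The inclusion of `M(2) = ℝ² × S¹` into `ℂ² × ℂ*`. -/
def M2.toComplex (g : M2) : (Fin 2 → ℂ) × ℂ := (fun i => (g.trans i : ℂ), (g.rot : ℂ))

/-- `F` represents a holomorphic function on `ℂ² × ℂ*`: it is holomorphic there, and, in order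
that `F` be determined by its restriction to `ℂ² × ℂ*`, it has the value `0` elsewhere. -/
def IsHolomorphicOnComplexM2 (F : (Fin 2 → ℂ) × ℂ → ℂ) : Prop :=
  DifferentiableOn ℂ F complexM2 ∧ ∀ p, p ∉ complexM2 → F p = 0

/-- `dμ(z) = (2πt)⁻¹ e^{-|y|²/2t} dx dy` on `ℂ²`, where `z = x + iy`. -/
def muMeasure (t : ℝ) : Measure (Fin 2 → ℂ) :=
  volume.withDensity fun z => ENNReal.ofReal
    (1 / (2 * Real.pi * t) * Real.exp (-((z 0).im ^ 2 + (z 1).im ^ 2) / (2 * t)))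

/-- `dν(w) = (2π)⁻¹ (2πt)^{-1/2} e^{-(ln |w|)²/2t} |w|⁻² dw` on `ℂ* = ℂ ∖ {0}`, where `dw` is the
Lebesgue measure. -/
def nuMeasure (t : ℝ) : Measure ℂ :=
  (volume.restrict {0}ᶜ).withDensity fun w => ENNReal.ofReal
    (1 / (2 * Real.pi) * (1 / Real.sqrt (2 * Real.pi * t)) *
      (Real.exp (-(Real.log ‖w‖) ^ 2 / (2 * t)) / ‖w‖ ^ 2))

/-- The linear space of the holomorphic functions on `ℂ² × ℂ*` that are square integrable with
respect to `μ ⊗ ν`. -/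
def bergmanSubmodule (t : ℝ) : Submodule ℂ ((Fin 2 → ℂ) × ℂ → ℂ) where
  carrier := {F | IsHolomorphicOnComplexM2 F ∧ MemLp F 2 ((muMeasure t).prod (nuMeasure t))}
  zero_mem' := ⟨⟨differentiableOn_const 0, fun _ _ => rfl⟩, MemLp.zero⟩
  add_mem' := by
    rintro F G ⟨⟨hF, hF0⟩, hF2⟩ ⟨⟨hG, hG0⟩, hG2⟩
    exact ⟨⟨hF.add hG, fun p hp => by simp [hF0 p hp, hG0 p hp]⟩, hF2.add hG2⟩
  smul_mem' := by
    rintro c F ⟨⟨hF, hF0⟩, hF2⟩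
    exact ⟨⟨hF.const_smul c, fun p hp => by simp [hF0 p hp]⟩, hF2.const_smul c⟩

/-- The weighted Bergman space `𝓗(ℂ² × ℂ*)`, for `t > 0`. -/
def BergmanSpace (t : ℝ) (_ht : 0 < t) : Type := bergmanSubmodule t

namespace BergmanSpace

variable {t : ℝ} {ht : 0 < t}

instance : AddCommGroup (BergmanSpace t ht) := inferInstanceAs (AddCommGroup (bergmanSubmodule t))

instance : Module ℂ (BergmanSpace t ht) := inferInstanceAs (Module ℂ (bergmanSubmodule t))

instance : CoeFun (BergmanSpace t ht) fun _ => (Fin 2 → ℂ) × ℂ → ℂ := ⟨fun F => F.1⟩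

/-- The inner product `⟪F, G⟫ = ∫ conj F * G d(μ ⊗ ν)` (conjugate linear in the first variable). -/
instance : Inner ℂ (BergmanSpace t ht) :=
  ⟨fun F G => ∫ p, conj (F p) * G p ∂(muMeasure t).prod (nuMeasure t)⟩

theorem integrable_inner (F G : BergmanSpace t ht) :
    Integrable (fun p => conj (F p) * G p) ((muMeasure t).prod (nuMeasure t)) :=
  F.2.2.star.integrable_mul G.2.2

theorem inner_self_eq (F : BergmanSpace t ht) :
    inner ℂ F F = ((∫ p, ‖F p‖ ^ 2 ∂(muMeasure t).prod (nuMeasure t) : ℝ) : ℂ) := by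
  rw [← integral_complex_ofReal]
  refine integral_congr_ae (Filter.Eventually.of_forall fun p => ?_)
  simp [Complex.conj_mul']

theorem volume_ac_mu (ht : 0 < t) : volume ≪ muMeasure t := by
  refine withDensity_absolutelyContinuous' (by fun_prop)
    (Filter.Eventually.of_forall fun z => ?_)
  have := Real.pi_pos
  exact (ENNReal.ofReal_pos.2 (by positivity)).ne'

theorem volume_ac_nu (ht : 0 < t) : volume.restrict {0}ᶜ ≪ nuMeasure t := by
  refine withDensity_absolutelyContinuous' (Measurable.aemeasurable (by fun_prop)) ?_
  refine (ae_restrict_iff' (by measurability)).2 (Filter.Eventually.of_forall fun w hw => ?_)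
  have := Real.pi_pos
  have hw' : 0 < ‖w‖ := norm_pos_iff.2 (by simpa using hw)
  exact (ENNReal.ofReal_pos.2 (by positivity)).ne'

theorem eq_zero_of_ae (F : BergmanSpace t ht)
    (h : (fun p => F p) =ᵐ[(muMeasure t).prod (nuMeasure t)] 0) : F = 0 := by
  have h1 : (volume : Measure (Fin 2 → ℂ)).prod (volume.restrict ({0}ᶜ : Set ℂ)) ≪
      (muMeasure t).prod (nuMeasure t) :=
    haveI : SFinite (nuMeasure t) := by unfold nuMeasure; infer_instance
    (volume_ac_mu ht).prod (volume_ac_nu ht)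
  have h2 := h1.ae_eq h
  have h3 : (volume : Measure (Fin 2 → ℂ)).prod (volume.restrict ({0}ᶜ : Set ℂ)) =
      (volume : Measure ((Fin 2 → ℂ) × ℂ)).restrict complexM2 := by
    have e : complexM2 = univ ×ˢ ({0}ᶜ : Set ℂ) := by ext p; simp [complexM2]
    rw [e, Measure.volume_eq_prod, ← Measure.prod_restrict, Measure.restrict_univ]
  rw [h3] at h2
  have ho : IsOpen complexM2 := isOpen_ne.preimage continuous_snd
  have h4 := Measure.eqOn_open_of_ae_eq h2 ho F.2.1.1.continuousOn continuousOn_const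
  refine Subtype.ext (funext fun p => ?_)
  by_cases hp : p ∈ complexM2
  · exact h4 hp
  · exact F.2.1.2 p hp

/-- The inner product space structure on the Bergman space; its norm is
`‖F‖ = (∫ |F|² d(μ ⊗ ν))^{1/2}`. -/
abbrev core : InnerProductSpace.Core ℂ (BergmanSpace t ht) where
  conj_inner_symm F G := by
    change conj (∫ p, conj (G p) * F p ∂_) = ∫ p, conj (F p) * G p ∂_
    rw [← integral_conj]
    simp [mul_comm]
  re_inner_nonneg F := by
    rw [inner_self_eq]
    simpa using integral_nonneg fun p => by positivity
  add_left F G H := by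
    change ∫ p, conj (F p + G p) * H p ∂_ = (∫ p, conj (F p) * H p ∂_) + ∫ p, conj (G p) * H p ∂_
    rw [← integral_add (integrable_inner F H) (integrable_inner G H)]
    simp [add_mul]
  smul_left F G c := by
    change ∫ p, conj (c * F p) * G p ∂_ = conj c * ∫ p, conj (F p) * G p ∂_
    rw [← integral_const_mul]
    simp [mul_assoc]
  definite F hF := by
    rw [inner_self_eq, Complex.ofReal_eq_zero,
      integral_eq_zero_iff_of_nonneg (fun p => by positivity) (F.2.2.integrable_norm_pow (by simp))]
      at hF
    refine eq_zero_of_ae F (hF.mono fun p hp => ?_)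
    simpa using hp

instance : NormedAddCommGroup (BergmanSpace t ht) := core.toNormedAddCommGroup

instance : InnerProductSpace ℂ (BergmanSpace t ht) := InnerProductSpace.ofCore core.toCore

end BergmanSpace

end

noncomputable section

/-! ### Complex analysis -/

/-! Rotations preserve the norm of `ℝ²`, so `ψ_t(h⁻¹g)` depends only on the difference of the
translation parts and the quotient of the rotation parts. The transform is therefore convolution
with the heat kernel of the direct product `ℝ² × S¹`, and the noncommutativity of `M(2)` plays no
further role.

Unitarity is proved by comparing Gram matrices. For `q ∈ ℂ²` and `n ∈ ℤ` take the Gaussian at time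
`t` centred at `conj q`, times the character `uⁿ` (`testFun`). By the semigroup law of the heat
kernel and the orthogonality of characters, its transform is the Gaussian at time `2t` centred at
`conj q`, times `e^{-n²t} wⁿ` (`heatTransform_testVec`). In the Bergman space, pairing `F` with this
function gives `e^{n²t}` times the `n`-th Laurent coefficient of `F(q, ·)` (`inner_testBergman`).
The reason is that each weight times the conjugate of its factor is a function invariant under
rotations, about `q` in `ℂ²` and about `0` in `ℂ*`, times a holomorphic function; the mean value
property does the rest. Hence the pairings of the test functions agree on both sides
(`inner_testBergman_testBergman`).

Both families are total: in `L²(M(2))` because imaginary centres turn the Gaussians into plane waves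
times one fixed Gaussian (`eq_zero_of_inner_testVec_eq_zero`), in the Bergman space because a
function whose Laurent coefficients all vanish is zero (`eq_zero_of_inner_testBergman_eq_zero`). So
the transform is isometric on a dense subspace. Point evaluations are continuous in `f`, hence
Fatou's lemma and density extend the isometry to all of `L²(M(2))`; its range is complete with
trivial orthogonal complement. -/

/-- Cauchy's estimate on the complex line through `p` in the direction `v`. -/
theorem norm_fderiv_apply_le_of_norm_le {E : Type*} [NormedAddCommGroup E] [NormedSpace ℂ E]
    {f : E → ℂ} {p : E} {ε C : ℝ} (hε : 0 < ε)
    (hf : DifferentiableOn ℂ f (Metric.ball p ε)) (hC : ∀ q ∈ Metric.ball p ε, ‖f q‖ ≤ C) :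
    ‖fderiv ℂ f p‖ ≤ 2 * C / ε := by
  have hC0 : 0 ≤ C := (norm_nonneg _).trans (hC p (Metric.mem_ball_self hε))
  have hfp : DifferentiableAt ℂ f p := hf.differentiableAt (Metric.ball_mem_nhds p hε)
  refine ContinuousLinearMap.opNorm_le_bound _ (by positivity) fun v => ?_
  rcases eq_or_ne v 0 with rfl | hv
  · simp
  have hv' : 0 < ‖v‖ := norm_pos_iff.2 hv
  -- With this radius the closed disc is mapped into the ball of radius `ε / 2`; hence the factor 2
  -- in the bound.
  set R : ℝ := ε / (2 * ‖v‖) with hR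
  have hR0 : 0 < R := by positivity
  have hmem : ∀ s ∈ Metric.closedBall (0 : ℂ) R, p + s • v ∈ Metric.ball p ε := by
    intro s hs
    rw [mem_closedBall_zero_iff] at hs
    rw [Metric.mem_ball, dist_self_add_left, norm_smul]
    calc ‖s‖ * ‖v‖ ≤ R * ‖v‖ := by gcongr
      _ = ε / 2 := by rw [hR]; field_simp
      _ < ε := by linarith
  have hd : DifferentiableOn ℂ (fun s : ℂ => f (p + s • v)) (Metric.closedBall 0 R) :=
    hf.comp (by fun_prop) hmem
  have hder : HasDerivAt (fun s : ℂ => f (p + s • v)) (fderiv ℂ f p v) 0 := by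
    have h1 : HasDerivAt (fun s : ℂ => p + s • v) v 0 := by
      simpa using ((hasDerivAt_id (0 : ℂ)).smul_const v).const_add p
    have h2 : HasFDerivAt f (fderiv ℂ f p) (p + (0 : ℂ) • v) := by
      simpa using hfp.hasFDerivAt
    exact h2.comp_hasDerivAt 0 h1
  have := Complex.norm_deriv_le_of_forall_mem_sphere_norm_le hR0
    (hd.diffContOnCl_ball subset_rfl)
    (fun s hs => hC _ (hmem s (Metric.sphere_subset_closedBall hs)))
  rw [hder.deriv] at this
  refine this.trans (le_of_eq ?_)
  rw [hR]; field_simp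

/-- A locally dominated integral of holomorphic functions is holomorphic. -/
theorem differentiableOn_integral_of_dominated {E α : Type*} [NormedAddCommGroup E]
    [NormedSpace ℂ E] [FiniteDimensional ℂ E] [MeasurableSpace α] {m : Measure α}
    {k : E → α → ℂ} {U : Set E}
    (hm : ∀ p ∈ U, AEStronglyMeasurable (k p) m)
    (hd : ∀ a, DifferentiableOn ℂ (fun p => k p a) U)
    (hB : ∀ p ∈ U, ∃ ε > 0, Metric.ball p ε ⊆ U ∧ ∃ B : α → ℝ, Integrable B m ∧
      ∀ q ∈ Metric.ball p ε, ∀ a, ‖k q a‖ ≤ B a) :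
    DifferentiableOn ℂ (fun p => ∫ a, k p a ∂m) U := by
  intro p hp
  obtain ⟨ε, hε, hU, B, hBi, hB⟩ := hB p hp
  have hUn : U ∈ nhds p := Filter.mem_of_superset (Metric.ball_mem_nhds p hε) hU
  have hda : ∀ a, ∀ q ∈ Metric.ball p ε, DifferentiableAt ℂ (fun p => k p a) q := fun a q hq =>
    ((hd a).mono hU).differentiableAt (Metric.isOpen_ball.mem_nhds hq)
  -- Directional derivatives are limits of the sequence of difference quotients, hence measurable in
  -- the parameter; a basis then gives measurability of the full derivative.
  have hdir : ∀ v : E, AEStronglyMeasurable (fun a => fderiv ℂ (fun p => k p a) p v) m := by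
    intro v
    have hlim : ∀ a, Filter.Tendsto
        (fun n : ℕ => (n : ℂ) • (k (p + (n : ℂ)⁻¹ • v) a - k p a)) Filter.atTop
        (nhds (fderiv ℂ (fun p => k p a) p v)) := by
      intro a
      refine (hda a p (Metric.mem_ball_self hε)).hasFDerivAt.lim v (c := fun n : ℕ => (n : ℂ)) ?_
      simpa only [Complex.norm_natCast] using tendsto_natCast_atTop_atTop (R := ℝ)
    have hev : ∀ᶠ n : ℕ in Filter.atTop, p + (n : ℂ)⁻¹ • v ∈ U := by
      have : Filter.Tendsto (fun n : ℕ => p + (n : ℂ)⁻¹ • v) Filter.atTop (nhds p) := by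
        have h0 : Filter.Tendsto (fun n : ℕ => (n : ℂ)⁻¹) Filter.atTop (nhds 0) :=
          tendsto_inv_atTop_nhds_zero_nat (𝕜 := ℂ)
        simpa using (h0.smul_const v).const_add p
      exact this hUn
    obtain ⟨N, hN⟩ := Filter.eventually_atTop.1 hev
    -- The shift by `N` keeps the points inside `U`, where measurability is assumed.
    refine aestronglyMeasurable_of_tendsto_ae Filter.atTop
      (f := fun (n : ℕ) a => ((n + N : ℕ) : ℂ) • (k (p + ((n + N : ℕ) : ℂ)⁻¹ • v) a - k p a))
      (fun n => ?_) (Filter.Eventually.of_forall fun a => ?_)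
    · have h0 := (hm _ (hN (n + N) (by omega))).sub (hm p hp)
      exact h0.const_smul ((n + N : ℕ) : ℂ)
    · exact (hlim a).comp (Filter.tendsto_add_atTop_nat N)
  have hmeas : AEStronglyMeasurable (fun a => fderiv ℂ (fun p => k p a) p) m := by
    let b := Module.finBasis ℂ E
    have : (fun a => fderiv ℂ (fun p => k p a) p) = fun a => ∑ i,
        (fderiv ℂ (fun p => k p a) p (b i)) • (LinearMap.toContinuousLinearMap (b.coord i)) := by
      funext a
      ext v
      conv_lhs => rw [← b.sum_repr v, map_sum]
      simp only [map_smul, smul_eq_mul, _root_.sum_apply,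
        _root_.smul_apply, LinearMap.coe_toContinuousLinearMap', Module.Basis.coord_apply]
      exact Finset.sum_congr rfl fun i _ => mul_comm _ _
    rw [this]
    have h2 : ∀ i, AEStronglyMeasurable (fun a => (fderiv ℂ (fun p => k p a) p (b i)) •
        (LinearMap.toContinuousLinearMap (b.coord i))) m := fun i => (hdir (b i)).smul_const _
    exact Finset.aestronglyMeasurable_fun_sum _ fun i _ => h2 i
  refine (hasFDerivAt_integral_of_dominated_of_fderiv_le
    (F' := fun q a => fderiv ℂ (fun p => k p a) q) (s := Metric.ball p (ε / 2))
    -- Cauchy's estimate on the ball of radius `ε / 2` about a point `q` of the half-size ball.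
    (bound := fun a => 2 * B a / (ε / 2))
    (Metric.ball_mem_nhds p (by positivity)) ?_ ?_ hmeas ?_ ?_ ?_).differentiableAt.differentiableWithinAt
  · exact Filter.eventually_of_mem hUn hm
  · exact hBi.mono' (hm p hp) (Filter.Eventually.of_forall (hB p (Metric.mem_ball_self hε)))
  · refine Filter.Eventually.of_forall fun a q hq => ?_
    have hsub : Metric.ball q (ε / 2) ⊆ Metric.ball p ε := by
      refine Metric.ball_subset_ball' ?_
      rw [Metric.mem_ball] at hq
      linarith
    exact norm_fderiv_apply_le_of_norm_le (by positivity) ((hd a).mono (hsub.trans hU))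
      fun r hr => hB r (hsub hr) a
  · exact (hBi.const_mul 2).div_const _
  · refine Filter.Eventually.of_forall fun a q hq => ?_
    exact (hda a q (Metric.ball_subset_ball (by linarith) hq)).hasFDerivAt

/-- Supplies the accumulation point that the identity theorem needs for functions vanishing on `ℝ`.
-/
theorem frequently_ofReal_nhdsWithin (x : ℝ) {P : ℂ → Prop} (h : ∀ r : ℝ, P r) :
    ∃ᶠ z in nhdsWithin (x : ℂ) {(x : ℂ)}ᶜ, P z := by
  have ht : Filter.Tendsto (fun n : ℕ => ((x + 1 / ((n : ℝ) + 1) : ℝ) : ℂ)) Filter.atTop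
      (nhdsWithin (x : ℂ) {(x : ℂ)}ᶜ) := by
    refine tendsto_nhdsWithin_iff.2 ⟨?_, Filter.Eventually.of_forall fun n => ?_⟩
    · have h1 : Filter.Tendsto (fun n : ℕ => x + 1 / ((n : ℝ) + 1)) Filter.atTop (nhds x) := by
        simpa using tendsto_one_div_add_atTop_nhds_zero_nat.const_add x
      exact (Complex.continuous_ofReal.tendsto x).comp h1
    · have : (0 : ℝ) < 1 / ((n : ℝ) + 1) := by positivity
      simp only [mem_compl_iff, mem_singleton_iff, Complex.ofReal_inj]
      linarith
  exact ht.frequently (Filter.Frequently.of_forall fun n => h _)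

theorem frequently_circle_nhdsWithin {P : ℂ → Prop} (h : ∀ u : Circle, P u) :
    ∃ᶠ z in nhdsWithin (1 : ℂ) {(1 : ℂ)}ᶜ, P z := by
  have ht : Filter.Tendsto (fun n : ℕ => ((Circle.exp (1 / ((n : ℝ) + 1)) : Circle) : ℂ))
      Filter.atTop (nhdsWithin (1 : ℂ) {(1 : ℂ)}ᶜ) := by
    refine tendsto_nhdsWithin_iff.2 ⟨?_, Filter.Eventually.of_forall fun n => ?_⟩
    · have h1 : Filter.Tendsto (fun n : ℕ => 1 / ((n : ℝ) + 1)) Filter.atTop (nhds 0) :=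
        tendsto_one_div_add_atTop_nhds_zero_nat
      have h2 : Continuous fun s : ℝ => ((Circle.exp s : Circle) : ℂ) := by fun_prop
      have h3 := (h2.tendsto 0).comp h1
      rwa [Circle.exp_zero, Circle.coe_one] at h3
    · have h0 : (0 : ℝ) < 1 / ((n : ℝ) + 1) := by positivity
      have h1 : 1 / ((n : ℝ) + 1) ≤ 1 := by
        rw [div_le_one (by positivity)]; linarith [n.cast_nonneg (α := ℝ)]
      simp only [mem_compl_iff, mem_singleton_iff]
      intro h
      have := congrArg Complex.im h
      rw [Circle.coe_exp, Complex.exp_ofReal_mul_I_im, Complex.one_im] at this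
      exact (Real.sin_pos_of_pos_of_lt_pi h0 (by linarith [Real.pi_gt_three])).ne' this
  exact ht.frequently (Filter.Frequently.of_forall fun n => h _)

theorem isOpen_complexM2 : IsOpen complexM2 := isOpen_ne.preimage continuous_snd

theorem DifferentiableOn.fst_slice {F : (Fin 2 → ℂ) × ℂ → ℂ} (hF : DifferentiableOn ℂ F complexM2)
    {w : ℂ} (hw : w ≠ 0) : Differentiable ℂ fun z => F (z, w) := fun z =>
  (hF.differentiableAt (isOpen_complexM2.mem_nhds (show (z, w) ∈ complexM2 from hw))).comp
    (f := fun z => (z, w)) z (by fun_prop)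

theorem DifferentiableOn.snd_slice {F : (Fin 2 → ℂ) × ℂ → ℂ} (hF : DifferentiableOn ℂ F complexM2)
    (z : Fin 2 → ℂ) : DifferentiableOn ℂ (fun w => F (z, w)) {0}ᶜ := fun w hw =>
  ((hF.differentiableAt (isOpen_complexM2.mem_nhds (show (z, w) ∈ complexM2 from hw))).comp
    (f := fun w => (z, w)) w (by fun_prop)).differentiableWithinAt

/-- `M(2)` is a set of uniqueness for the holomorphic functions on `ℂ² × ℂ*`. -/
theorem eqOn_complexM2_of_eq_on_M2 {F : (Fin 2 → ℂ) × ℂ → ℂ} (hF : DifferentiableOn ℂ F complexM2)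
    (h : ∀ g : M2, F g.toComplex = 0) : ∀ p ∈ complexM2, F p = 0 := by
  have entire : ∀ f : ℂ → ℂ, Differentiable ℂ f → (∀ x : ℝ, f x = 0) → ∀ z, f z = 0 := by
    intro f hf h0 z
    exact (hf.differentiableOn.analyticOnNhd isOpen_univ).eqOn_zero_of_preconnected_of_frequently_eq_zero
      isPreconnected_univ (mem_univ ((0 : ℝ) : ℂ)) (frequently_ofReal_nhdsWithin 0 h0) (mem_univ z)
  have slice : ∀ (a b : ℂ) (u : Circle), Differentiable ℂ (fun z : ℂ => F (![z, b], u)) ∧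
      Differentiable ℂ (fun z : ℂ => F (![a, z], u)) := by
    intro a b u
    have h1 := hF.fst_slice u.coe_ne_zero
    refine ⟨h1.comp (f := fun z : ℂ => ![z, b]) ?_, h1.comp (f := fun z : ℂ => ![a, z]) ?_⟩ <;>
    · refine differentiable_pi.2 fun i => ?_
      fin_cases i <;> simp
  have h1 : ∀ (x y : ℝ) (u : Circle), F (![(x : ℂ), (y : ℂ)], u) = 0 := by
    intro x y u
    rw [← h ⟨!₂[x, y], u⟩]
    congr 1
    refine Prod.ext (funext fun i => ?_) rfl
    fin_cases i <;> simp [M2.toComplex]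
  -- The identity theorem is applied one variable at a time: the two translation coordinates, then
  -- `w` on the connected punctured plane.
  have h2 : ∀ (a : ℂ) (y : ℝ) (u : Circle), F (![a, (y : ℂ)], u) = 0 := fun a y u =>
    entire _ (slice 0 y u).1 (fun x => h1 x y u) a
  have h3 : ∀ (a b : ℂ) (u : Circle), F (![a, b], u) = 0 := fun a b u =>
    entire _ (slice a 0 u).2 (fun y => h2 a y u) b
  rintro ⟨z, w⟩ hw
  have hz : z = ![z 0, z 1] := by ext i; fin_cases i <;> rfl
  refine ((hF.snd_slice z).analyticOnNhd isOpen_compl_singleton).eqOn_zero_of_preconnected_of_frequently_eq_zero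
    (isConnected_compl_singleton_of_one_lt_rank (by simp) 0).isPreconnected (by simp : (1 : ℂ) ∈ ({0}ᶜ : Set ℂ))
    (frequently_circle_nhdsWithin fun u => ?_) hw
  rw [hz]
  exact h3 _ _ u

/-! ### Averages over the circle -/

instance : IsProbabilityMeasure circleMeasure := by
  refine ⟨?_⟩
  have := Real.pi_pos
  rw [circleMeasure, Measure.smul_apply, Measure.map_apply (by fun_prop) MeasurableSet.univ,
    preimage_univ, Measure.restrict_apply_univ, Real.volume_Ioc, smul_eq_mul,
    ← ENNReal.ofReal_mul (by positivity), ← ENNReal.ofReal_one]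
  congr 1
  field_simp
  ring

theorem integral_circleMeasure (G : Circle → ℂ) (hG : Measurable G) :
    ∫ u, G u ∂circleMeasure = (2 * Real.pi : ℝ)⁻¹ • ∫ θ in -Real.pi..Real.pi, G (Circle.exp θ) := by
  have := Real.pi_pos
  rw [circleMeasure, integral_smul_measure, integral_map (by fun_prop) hG.aestronglyMeasurable,
    intervalIntegral.integral_of_le (by linarith), ENNReal.toReal_ofReal (by positivity), one_div]

/-- The factor `w / |w|` is absorbed by translating the angle by `arg w`, which is harmless by
periodicity. -/
theorem integral_circleMeasure_mul (G : ℂ → ℂ) (w : ℂ) (hG : Measurable fun u : Circle => G (u * w)) :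
    ∫ u : Circle, G (u * w) ∂circleMeasure = Real.circleAverage G 0 ‖w‖ := by
  rw [integral_circleMeasure (fun u => G (u * w)) hG, Real.circleAverage_eq_integral_add (Complex.arg w)]
  congr 1
  have hp : Function.Periodic (fun θ : ℝ => G (circleMap 0 ‖w‖ (θ + Complex.arg w))) (2 * Real.pi) := by
    intro θ
    change G _ = G _
    rw [add_right_comm, periodic_circleMap]
  have h2 := hp.intervalIntegral_add_eq 0 (-Real.pi)
  rw [zero_add, show -Real.pi + 2 * Real.pi = Real.pi by ring] at h2
  rw [h2]
  refine intervalIntegral.integral_congr fun θ _ => ?_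
  congr 1
  conv_lhs => rw [← Complex.norm_mul_exp_arg_mul_I w]
  simp only [Circle.coe_exp, circleMap, zero_add, Complex.ofReal_add, add_mul, Complex.exp_add]
  ring

theorem integral_circle_zpow (n : ℤ) :
    ∫ u : Circle, (u : ℂ) ^ n ∂circleMeasure = if n = 0 then 1 else 0 := by
  split_ifs with h
  · simp [h]
  have h1 := integral_circleMeasure_mul (fun v => v ^ n) 1
    (by simpa using (Measurable.pow_const (by fun_prop) n))
  simp only [mul_one, norm_one] at h1
  rw [h1, Real.circleAverage_eq_circleIntegral one_ne_zero]
  have : ∮ z in C(0, 1), (z - 0)⁻¹ • z ^ n = ∮ z in C(0, 1), (z - 0) ^ (n - 1) := by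
    refine circleIntegral.integral_congr zero_le_one fun z hz => ?_
    have hz0 : z ≠ 0 := by rintro rfl; simp at hz
    simp only [sub_zero, smul_eq_mul]
    rw [zpow_sub_one₀ hz0, mul_comm]
  rw [this, circleIntegral.integral_sub_zpow_of_ne (by omega), smul_zero]

/-- The Laurent coefficients do not depend on the radius of the circle of integration. -/
theorem circleAverage_eq_of_differentiableOn_compl_zero {G : ℂ → ℂ}
    (hG : DifferentiableOn ℂ G {0}ᶜ) {r : ℝ} (hr : 0 < r) :
    Real.circleAverage G 0 r = Real.circleAverage G 0 1 := by
  have key : ∀ r R : ℝ, 0 < r → r ≤ R →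
      Real.circleAverage G 0 R = Real.circleAverage G 0 r := by
    intro r R hr hrR
    rw [Real.circleAverage_eq_circleIntegral hr.ne',
      Real.circleAverage_eq_circleIntegral (hr.trans_le hrR).ne']
    congr 1
    -- The average is, up to a constant, the contour integral of `G(z) / z`, to which Cauchy's
    -- theorem on an annulus applies.
    have hd : DifferentiableOn ℂ (fun z : ℂ => (z - 0)⁻¹ • G z) {0}ᶜ := by
      refine DifferentiableOn.smul (c := fun z : ℂ => (z - 0)⁻¹)
        (DifferentiableOn.inv (differentiableOn_id.sub_const 0) fun z hz => ?_) hG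
      simpa using hz
    refine Complex.circleIntegral_eq_of_differentiable_on_annulus_off_countable hr hrR
      countable_empty (hd.continuousOn.mono ?_) fun z hz => hd.differentiableAt
        (isOpen_compl_singleton.mem_nhds ?_)
    · rintro z ⟨-, hz⟩ rfl
      exact hz (Metric.mem_ball_self hr)
    · rintro rfl
      exact hz.1.2 (Metric.mem_closedBall_self hr.le)
  rcases le_total r 1 with h | h
  · exact (key r 1 hr h).symm
  · exact key 1 r one_pos h

/-- Averaging an integrable function over the orbits of a measure preserving circle action. -/
theorem integral_eq_integral_circle_average {α : Type*} [MeasurableSpace α] {m : Measure α}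
    [SFinite m] {ρ : Circle → α → α} (hρ : Measurable (Function.uncurry ρ))
    (hm : ∀ u, MeasurePreserving (ρ u) m m) {H : α → ℂ} (hH : Integrable H m) :
    ∫ a, H a ∂m = ∫ a, ∫ u, H (ρ u a) ∂circleMeasure ∂m := by
  -- The skew product transports integrability of `H` to the product space, which justifies Fubini.
  have hs : MeasurePreserving (fun p : Circle × α => (p.1, ρ p.1 p.2))
      (circleMeasure.prod m) (circleMeasure.prod m) :=
    (MeasurePreserving.id circleMeasure).skew_product hρ
      (Filter.Eventually.of_forall fun u => (hm u).map_eq)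
  have hi : Integrable (fun p : Circle × α => H (ρ p.1 p.2)) (circleMeasure.prod m) := by
    have h1 : Integrable (fun p : Circle × α => H p.2) (circleMeasure.prod m) :=
      hH.comp_snd circleMeasure
    exact hs.integrable_comp_of_integrable h1
  have h2 := integral_integral_swap (f := fun u a => H (ρ u a)) hi
  rw [← h2]
  have h3 : ∀ u, ∫ a, H (ρ u a) ∂m = ∫ a, H a ∂m := by
    intro u
    have hH' : AEStronglyMeasurable H (m.map (ρ u)) := by
      rw [(hm u).map_eq]; exact hH.aestronglyMeasurable
    rw [← integral_map (hm u).measurable.aemeasurable hH', (hm u).map_eq]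
  simp [h3]

/-! ### Integrable functions orthogonal to a separating family of bounded continuous functions -/

/-- The positive and negative parts of `r` are densities of finite measures with equal integrals
over `A`. A separating star algebra determines a finite measure, so the two parts agree almost
everywhere; at each point one of them is zero, so both are. -/
theorem ae_eq_zero_of_integral_smul_eq_zero {X : Type*} [TopologicalSpace X] [PolishSpace X]
    [MeasurableSpace X] [BorelSpace X] {m : Measure X} {r : X → ℝ} (hr : Integrable r m)
    {A : StarSubalgebra ℂ (BoundedContinuousFunction X ℂ)}
    (hA : (A.map (BoundedContinuousFunction.toContinuousMapStarₐ ℂ)).SeparatesPoints)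
    (h : ∀ χ ∈ A, ∫ x, r x • χ x ∂m = 0) : r =ᵐ[m] 0 := by
  have fin : ∀ s : X → ℝ, Integrable s m → IsFiniteMeasure (m.withDensity fun x => ENNReal.ofReal (s x)) :=
    fun s hs => isFiniteMeasure_withDensity_ofReal hs.2
  have hneg : Integrable (fun x => -r x) m := hr.neg
  have := fin r hr
  have := fin _ hneg
  have key : m.withDensity (fun x => ENNReal.ofReal (r x)) =
      m.withDensity (fun x => ENNReal.ofReal (-r x)) := by
    refine ext_of_forall_mem_subalgebra_integral_eq_of_polish (𝕜 := ℂ) hA fun χ hχ => ?_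
    rw [integral_withDensity_eq_integral_toReal_smul₀ hr.aemeasurable.ennreal_ofReal (by simp),
      integral_withDensity_eq_integral_toReal_smul₀ hneg.aemeasurable.ennreal_ofReal (by simp),
      ← sub_eq_zero]
    have hint : ∀ s : X → ℝ, Integrable s m →
        Integrable (fun x => (ENNReal.ofReal (s x)).toReal • χ x) m := by
      intro s hs
      have h1 : Integrable (fun x => (ENNReal.ofReal (s x)).toReal) m := by
        simpa only [ENNReal.toReal_ofReal'] using hs.pos_part
      exact h1.smul_bdd ‖χ‖ χ.continuous.aestronglyMeasurable
        (Filter.Eventually.of_forall χ.norm_coe_le_norm)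
    rw [← integral_sub (hint _ hr) (hint _ hneg), ← h χ hχ]
    refine integral_congr_ae (Filter.Eventually.of_forall fun x => ?_)
    simp only [ENNReal.toReal_ofReal', ← sub_smul]
    congr 1
    rcases le_total (r x) 0 with h0 | h0
    · rw [max_eq_right h0, max_eq_left (by linarith)]; ring
    · rw [max_eq_left h0, max_eq_right (by linarith)]; ring
  rw [withDensity_eq_iff hr.aemeasurable.ennreal_ofReal hneg.aemeasurable.ennreal_ofReal
    hr.lintegral_lt_top.ne] at key
  filter_upwards [key] with x hx
  rcases le_total (r x) 0 with h0 | h0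
  · rw [ENNReal.ofReal_of_nonpos h0] at hx
    exact le_antisymm h0 (neg_nonpos.1 (ENNReal.ofReal_eq_zero.1 hx.symm))
  · rw [ENNReal.ofReal_of_nonpos (p := -r x) (by linarith)] at hx
    exact le_antisymm (ENNReal.ofReal_eq_zero.1 hx) h0

/-- The span of a submonoid closed under conjugation is a star algebra, so `conj g` is orthogonal to
it as well. The real and imaginary parts of `g` then fall under the real case. -/
theorem ae_eq_zero_of_integral_mul_eq_zero {X : Type*} [TopologicalSpace X] [PolishSpace X]
    [MeasurableSpace X] [BorelSpace X] {m : Measure X} {g : X → ℂ} (hg : Integrable g m)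
    (S : Submonoid (BoundedContinuousFunction X ℂ)) (hstar : ∀ χ ∈ S, star χ ∈ S)
    (hsep : ∀ x y, x ≠ y → ∃ χ ∈ S, χ x ≠ χ y) (h : ∀ χ ∈ S, ∫ x, χ x * g x ∂m = 0) :
    g =ᵐ[m] 0 := by
  have hint : ∀ χ : BoundedContinuousFunction X ℂ, Integrable (fun x => χ x * g x) m := fun χ =>
    hg.bdd_mul (c := ‖χ‖) χ.continuous.aestronglyMeasurable
      (Filter.Eventually.of_forall χ.norm_coe_le_norm)
  have hspan : ∀ χ, χ ∈ Algebra.adjoin ℂ (S : Set (BoundedContinuousFunction X ℂ)) ↔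
      χ ∈ Submodule.span ℂ (S : Set (BoundedContinuousFunction X ℂ)) := by
    intro χ
    rw [← Subalgebra.mem_toSubmodule, Algebra.adjoin_eq_span, Submonoid.closure_eq]
  let A : StarSubalgebra ℂ (BoundedContinuousFunction X ℂ) :=
    { Algebra.adjoin ℂ (S : Set (BoundedContinuousFunction X ℂ)) with
      star_mem' := by
        intro χ hχ
        change χ ∈ Algebra.adjoin ℂ _ at hχ
        change star χ ∈ Algebra.adjoin ℂ _
        rw [hspan] at hχ ⊢
        induction hχ using Submodule.span_induction with
        | mem χ hχ => exact Submodule.subset_span (hstar χ hχ)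
        | zero => rw [star_zero]; exact Submodule.zero_mem _
        | add χ η _ _ h1 h2 => rw [star_add]; exact Submodule.add_mem _ h1 h2
        | smul c χ _ h1 => rw [star_smul]; exact Submodule.smul_mem _ _ h1 }
  have hAspan : ∀ χ ∈ A, χ ∈ Submodule.span ℂ (S : Set (BoundedContinuousFunction X ℂ)) :=
    fun χ hχ => (hspan χ).1 hχ
  have hA : (A.map (BoundedContinuousFunction.toContinuousMapStarₐ ℂ)).SeparatesPoints := by
    intro x y hxy
    obtain ⟨χ, hχ, hne⟩ := hsep x y hxy
    exact ⟨_, ⟨BoundedContinuousFunction.toContinuousMapStarₐ ℂ χ,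
      ⟨χ, Algebra.subset_adjoin hχ, rfl⟩, rfl⟩, hne⟩
  have h1 : ∀ χ ∈ A, ∫ x, χ x * g x ∂m = 0 := by
    intro χ hχ
    replace hχ := hAspan χ hχ
    induction hχ using Submodule.span_induction with
    | mem χ hχ => exact h χ hχ
    | zero => simp
    | add χ η _ _ h1 h2 =>
      simp only [BoundedContinuousFunction.coe_add, Pi.add_apply, add_mul]
      rw [integral_add (hint χ) (hint η), h1, h2, add_zero]
    | smul c χ _ h1 =>
      simp only [BoundedContinuousFunction.coe_smul, smul_eq_mul, mul_assoc]
      rw [integral_const_mul, h1, mul_zero]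
  have h2 : ∀ χ ∈ A, ∫ x, χ x * conj (g x) ∂m = 0 := by
    intro χ hχ
    have := h1 (star χ) (star_mem hχ)
    have h3 := congrArg conj this
    rw [← integral_conj, map_zero] at h3
    simpa using h3
  have hint' : ∀ χ : BoundedContinuousFunction X ℂ, Integrable (fun x => χ x * conj (g x)) m := by
    intro χ
    refine Integrable.bdd_mul (c := ‖χ‖) ?_ χ.continuous.aestronglyMeasurable
      (Filter.Eventually.of_forall χ.norm_coe_le_norm)
    exact (Complex.conjCLE.integrable_comp_iff).2 hg
  have hre : (fun x => (g x).re) =ᵐ[m] 0 := by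
    refine ae_eq_zero_of_integral_smul_eq_zero hg.re hA fun χ hχ => ?_
    have h4 : ∀ x, (g x).re • χ x = (1 / 2 : ℂ) * (χ x * g x + χ x * conj (g x)) := by
      intro x
      rw [← mul_add, Complex.add_conj, Complex.real_smul]
      push_cast
      ring
    simp_rw [h4]
    rw [integral_const_mul, integral_add (hint χ) (hint' χ), h1 χ hχ, h2 χ hχ]
    simp
  have him : (fun x => (g x).im) =ᵐ[m] 0 := by
    refine ae_eq_zero_of_integral_smul_eq_zero hg.im hA fun χ hχ => ?_
    have h4 : ∀ x, (g x).im • χ x = (1 / (2 * Complex.I) : ℂ) * (χ x * g x - χ x * conj (g x)) := by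
      intro x
      rw [← mul_sub, Complex.sub_conj, Complex.real_smul]
      push_cast
      field_simp [Complex.I_ne_zero]
    simp_rw [h4]
    rw [integral_const_mul, integral_sub (hint χ) (hint' χ), h1 χ hχ, h2 χ hχ]
    simp
  filter_upwards [hre, him] with x hx hy
  exact Complex.ext hx hy

/-! ### The Gaussian and the theta function -/

/-- The heat kernel of `ℝ²` at time `s`, continued to `ℂ²`. -/
def gaussC (s : ℝ) (z : Fin 2 → ℂ) : ℂ :=
  (1 / (4 * Real.pi * s) : ℝ) * Complex.exp (-(z 0 ^ 2 + z 1 ^ 2) / (4 * s))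

theorem conj_gaussC (s : ℝ) (z : Fin 2 → ℂ) : conj (gaussC s z) = gaussC s fun i => conj (z i) := by
  simp only [gaussC, map_mul, Complex.conj_ofReal, ← Complex.exp_conj, map_div₀, map_neg, map_add,
    map_pow, map_ofNat]

theorem gaussC_sub_comm (s : ℝ) (z w : Fin 2 → ℂ) :
    (gaussC s fun i => z i - w i) = gaussC s fun i => w i - z i := by
  simp only [gaussC, sub_sq_comm]

@[fun_prop]
theorem differentiable_gaussC (s : ℝ) : Differentiable ℂ (gaussC s) := by
  unfold gaussC; fun_prop

theorem norm_gaussC {s : ℝ} (hs : 0 < s) (z : Fin 2 → ℂ) : ‖gaussC s z‖ = 1 / (4 * Real.pi * s) *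
    Real.exp (-((z 0).re ^ 2 + (z 1).re ^ 2 - (z 0).im ^ 2 - (z 1).im ^ 2) / (4 * s)) := by
  have := Real.pi_pos
  rw [gaussC, norm_mul, Complex.norm_real, Real.norm_of_nonneg (by positivity), Complex.norm_exp]
  congr 2
  have h4 : (4 * s : ℂ) = ((4 * s : ℝ) : ℂ) := by push_cast; rfl
  rw [h4, Complex.div_ofReal_re]
  simp only [Complex.neg_re, Complex.add_re, sq, Complex.mul_re]
  congr 1
  ring

/-- Half of the decay rate is given up, by `(x - y)² ≥ y²/2 - x²`, in order that the decay in `y` be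
uniform for bounded `z`. -/
theorem norm_gaussC_sub_le {t : ℝ} (ht : 0 < t) (z : Fin 2 → ℂ) (y : EuclideanSpace ℝ (Fin 2)) :
    ‖gaussC t fun i => z i - y i‖ ≤ 1 / (4 * Real.pi * t) *
      Real.exp ((‖z 0‖ ^ 2 + ‖z 1‖ ^ 2) / (4 * t)) * Real.exp (-‖y‖ ^ 2 / (8 * t)) := by
  have := Real.pi_pos
  rw [norm_gaussC ht, mul_assoc (1 / (4 * Real.pi * t)), ← Real.exp_add]
  gcongr
  have e : (‖z 0‖ ^ 2 + ‖z 1‖ ^ 2) / (4 * t) + -‖y‖ ^ 2 / (8 * t) =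
      (‖z 0‖ ^ 2 + ‖z 1‖ ^ 2 - ‖y‖ ^ 2 / 2) / (4 * t) := by
    field_simp
    ring
  rw [e]
  gcongr
  simp only [EuclideanSpace.real_norm_sq_eq, Fin.sum_univ_two, Complex.sq_norm,
    Complex.normSq_apply, Complex.sub_re, Complex.sub_im, Complex.ofReal_re, Complex.ofReal_im]
  nlinarith [sq_nonneg (2 * (z 0).re - y 0), sq_nonneg (2 * (z 1).re - y 1)]

/-- The semigroup law of the heat kernel, with complex end points: the exponent is a real quadratic
form plus a complex linear form, so the Gaussian integral is explicit. -/
theorem integral_gaussC_mul_gaussC {t : ℝ} (ht : 0 < t) (a b : Fin 2 → ℂ) :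
    ∫ y : EuclideanSpace ℝ (Fin 2), gaussC t (fun i => y i - a i) * gaussC t (fun i => b i - y i) =
      gaussC (2 * t) fun i => b i - a i := by
  have hpi := Real.pi_pos
  have ht' : (t : ℂ) ≠ 0 := by exact_mod_cast ht.ne'
  have hpi' : (Real.pi : ℂ) ≠ 0 := by exact_mod_cast hpi.ne'
  rw [← (PiLp.volume_preserving_toLp (Fin 2)).integral_comp
    (MeasurableEquiv.toLp 2 _).measurableEmbedding]
  have hb : 0 < ((1 / (2 * t) : ℝ) : ℂ).re := by
    rw [Complex.ofReal_re]; positivity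
  have key := GaussianFourier.integral_cexp_neg_mul_sum_add hb
    (fun i : Fin 2 => (a i + b i) / (2 * t))
  have h1 : ∀ v : Fin 2 → ℝ, gaussC t (fun i => ((WithLp.toLp 2 v i : ℝ) : ℂ) - a i) *
      gaussC t (fun i => b i - ((WithLp.toLp 2 v i : ℝ) : ℂ)) =
      ((1 / (4 * Real.pi * t) : ℝ) : ℂ) ^ 2 *
        Complex.exp (-(a 0 ^ 2 + a 1 ^ 2 + b 0 ^ 2 + b 1 ^ 2) / (4 * t)) *
      Complex.exp (-((1 / (2 * t) : ℝ) : ℂ) * ∑ i, (v i : ℂ) ^ 2 +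
        ∑ i, (a i + b i) / (2 * t) * v i) := by
    intro v
    simp only [gaussC]
    rw [mul_mul_mul_comm, ← Complex.exp_add, mul_assoc (_ ^ 2), ← Complex.exp_add,
      sq ((1 / (4 * Real.pi * t) : ℝ) : ℂ)]
    congr 2
    simp only [Fin.sum_univ_two]
    push_cast
    field_simp
    ring
  simp_rw [h1]
  rw [integral_const_mul, key]
  have hc : ((Fintype.card (Fin 2) : ℕ) / 2 : ℂ) = 1 := by simp
  rw [hc, Complex.cpow_one, gaussC]
  rw [mul_comm ((Real.pi : ℂ) / _) _, ← mul_assoc, mul_assoc (((1 / (4 * Real.pi * t) : ℝ) : ℂ) ^ 2),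
    ← Complex.exp_add, mul_right_comm]
  congr 1
  · push_cast
    field_simp
    norm_num
  · congr 1
    simp only [Fin.sum_univ_two]
    push_cast
    field_simp
    ring

/-- The theta function `∑ e^{-n²t} wⁿ`, that is, the heat kernel of the circle continued
to `ℂ*`; its value at `0` is `0`. -/
def thetaC (t : ℝ) (w : ℂ) : ℂ :=
  if w = 0 then 0 else ∑' n : ℤ, (Real.exp (-(n : ℝ) ^ 2 * t) : ℂ) * w ^ n

/-- The terms are the norms of those of the Jacobi theta series with `τ = it/π` and `z = -i log r /
2π`. -/
theorem summable_theta {t : ℝ} (ht : 0 < t) {r : ℝ} (hr : 0 < r) :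
    Summable fun n : ℤ => Real.exp (-(n : ℝ) ^ 2 * t) * r ^ n := by
  have hτ : 0 < (Complex.I * (t / Real.pi : ℝ)).im := by
    simp only [Complex.I_mul_im, Complex.ofReal_re]
    have := Real.pi_pos
    positivity
  have h := ((summable_jacobiTheta₂_term_iff
    (Complex.I * (-Real.log r / (2 * Real.pi) : ℝ)) _).2 hτ).norm
  refine h.congr fun n => ?_
  rw [norm_jacobiTheta₂_term, ← Real.rpow_intCast, Real.rpow_def_of_pos hr, ← Real.exp_add]
  congr 1
  simp only [Complex.I_mul_im, Complex.ofReal_re]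
  field_simp [Real.pi_ne_zero]
  ring

/-- The first summand dominates for `n ≥ 0`, the second for `n ≤ 0`; their sum is a majorant uniform
on the annulus. -/
theorem norm_zpow_le_add {R : ℝ} {w : ℂ} (hw : w ≠ 0) (h1 : R⁻¹ ≤ ‖w‖) (h2 : ‖w‖ ≤ R) (n : ℤ) :
    ‖w ^ n‖ ≤ R ^ n + R⁻¹ ^ n := by
  have hw' : 0 < ‖w‖ := norm_pos_iff.2 hw
  have hR : 0 < R := hw'.trans_le h2
  rw [norm_zpow]
  rcases le_total 0 n with hn | hn
  · exact (zpow_le_zpow_left₀ hn hw'.le h2).trans (le_add_of_nonneg_right (by positivity))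
  · obtain ⟨m, rfl⟩ : ∃ m, n = -m := ⟨-n, by ring⟩
    have h3 : ‖w‖ ^ (-m) ≤ R⁻¹ ^ (-m) := by
      rw [zpow_neg, zpow_neg]
      exact inv_anti₀ (by positivity) (zpow_le_zpow_left₀ (by omega) (by positivity) h1)
    exact h3.trans (le_add_of_nonneg_left (by positivity))

theorem summable_theta_majorant {t : ℝ} (ht : 0 < t) {R : ℝ} (hR : 0 < R) :
    Summable fun n : ℤ => Real.exp (-(n : ℝ) ^ 2 * t) * (R ^ n + R⁻¹ ^ n) := by
  simp_rw [mul_add]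
  exact (summable_theta ht hR).add (summable_theta ht (inv_pos.2 hR))

theorem norm_theta_term_le (t : ℝ) {R : ℝ} {w : ℂ} (hw : w ≠ 0) (h1 : R⁻¹ ≤ ‖w‖) (h2 : ‖w‖ ≤ R)
    (n : ℤ) : ‖(Real.exp (-(n : ℝ) ^ 2 * t) : ℂ) * w ^ n‖ ≤
      Real.exp (-(n : ℝ) ^ 2 * t) * (R ^ n + R⁻¹ ^ n) := by
  rw [norm_mul, Complex.norm_real, Real.norm_of_nonneg (Real.exp_pos _).le]
  gcongr
  exact norm_zpow_le_add hw h1 h2 n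

theorem norm_thetaC_le {t : ℝ} (ht : 0 < t) {R : ℝ} {w : ℂ} (hw : w ≠ 0) (h1 : R⁻¹ ≤ ‖w‖)
    (h2 : ‖w‖ ≤ R) :
    ‖thetaC t w‖ ≤ ∑' n : ℤ, Real.exp (-(n : ℝ) ^ 2 * t) * (R ^ n + R⁻¹ ^ n) := by
  rw [thetaC, if_neg hw]
  have hR : 0 < R := (norm_pos_iff.2 hw).trans_le h2
  exact tsum_of_norm_bounded (summable_theta_majorant ht hR).hasSum (norm_theta_term_le t hw h1 h2)

theorem differentiableOn_thetaC {t : ℝ} (ht : 0 < t) : DifferentiableOn ℂ (thetaC t) {0}ᶜ := by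
  intro w hw
  have hw' : 0 < ‖w‖ := norm_pos_iff.2 hw
  set R : ℝ := ‖w‖ + ‖w‖⁻¹ with hR
  have hR0 : 0 < R := by positivity
  let V : Set ℂ := {v | R⁻¹ < ‖v‖ ∧ ‖v‖ < R}
  have hV : IsOpen V := (isOpen_lt continuous_const continuous_norm).inter
    (isOpen_lt continuous_norm continuous_const)
  have hwV : w ∈ V := by
    refine ⟨?_, ?_⟩
    · rw [inv_lt_comm₀ hR0 hw']
      linarith
    · have : 0 < ‖w‖⁻¹ := by positivity
      linarith
  have hV0 : ∀ v ∈ V, v ≠ 0 := by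
    rintro v hv rfl
    have := hv.1
    rw [norm_zero] at this
    exact absurd this (by have := inv_pos.2 hR0; linarith)
  have hd : DifferentiableOn ℂ
      (fun v : ℂ => ∑' n : ℤ, (Real.exp (-(n : ℝ) ^ 2 * t) : ℂ) * v ^ n) V := by
    refine Complex.differentiableOn_tsum_of_summable_norm (summable_theta_majorant ht hR0)
      (fun n => ?_) hV fun n v hv => norm_theta_term_le t (hV0 v hv) hv.1.le hv.2.le n
    exact fun v hv => ((differentiableAt_zpow.2 (Or.inl (hV0 v hv))).const_mul _).differentiableWithinAt
  refine ((hd.congr fun v hv => ?_).differentiableAt (hV.mem_nhds hwV)).differentiableWithinAt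
  rw [thetaC, if_neg (hV0 v hv)]

theorem measurable_thetaC {t : ℝ} (ht : 0 < t) : Measurable (thetaC t) := by
  refine measurable_of_continuousOn_compl_singleton 0 (differentiableOn_thetaC ht).continuousOn

/-- Orthogonality of characters leaves only the `n`-th term of the series; absolute convergence
permits termwise integration. -/
theorem integral_zpow_mul_thetaC {t : ℝ} (ht : 0 < t) (n : ℤ) {w : ℂ} (hw : w ≠ 0) :
    ∫ u : Circle, (u : ℂ) ^ n * thetaC t (w / u) ∂circleMeasure =
      (Real.exp (-(n : ℝ) ^ 2 * t) : ℂ) * w ^ n := by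
  let F : ℤ → Circle → ℂ := fun m u => (Real.exp (-(m : ℝ) ^ 2 * t) : ℂ) * w ^ m * (u : ℂ) ^ (n - m)
  have hm : ∀ k : ℤ, Measurable fun u : Circle => (u : ℂ) ^ k := fun k =>
    Measurable.pow_const (by fun_prop) k
  have hn : ∀ m u, ‖F m u‖ = Real.exp (-(m : ℝ) ^ 2 * t) * ‖w‖ ^ m := by
    intro m u
    simp only [F, norm_mul, norm_zpow, Circle.norm_coe, one_zpow, mul_one, Complex.norm_real,
      Real.norm_of_nonneg (Real.exp_pos _).le]
  have hi : ∀ m, Integrable (F m) circleMeasure := fun m =>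
    Integrable.of_bound ((hm _).const_mul _).aestronglyMeasurable _
      (Filter.Eventually.of_forall fun u => (hn m u).le)
  have hs : Summable fun m => ∫ u, ‖F m u‖ ∂circleMeasure := by
    simp_rw [hn]
    simpa using summable_theta ht (norm_pos_iff.2 hw)
  have h1 := integral_tsum_of_summable_integral_norm hi hs
  have h2 : ∀ u : Circle, (u : ℂ) ^ n * thetaC t (w / u) = ∑' m, F m u := by
    intro u
    rw [thetaC, if_neg (div_ne_zero hw u.coe_ne_zero), ← tsum_mul_left]
    refine tsum_congr fun m => ?_
    simp only [F]
    rw [div_zpow, zpow_sub₀ u.coe_ne_zero]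
    ring
  simp_rw [h2]
  rw [← h1, tsum_eq_single n]
  · simp [F]
  · intro m hm
    simp only [F]
    rw [integral_const_mul, integral_circle_zpow, if_neg (by omega), mul_zero]

/-! ### Integration on the rigid motion group -/

/-- `M(2)` is `ℝ² × S¹` as a measurable space. -/
def M2.measurableEquivProd : M2 ≃ᵐ EuclideanSpace ℝ (Fin 2) × Circle where
  toFun g := (g.trans, g.rot)
  invFun p := ⟨p.1, p.2⟩
  left_inv _ := rfl
  right_inv _ := rfl
  measurable_toFun := comap_measurable _
  measurable_invFun := measurable_comap_iff.2 measurable_id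

theorem M2.measurePreserving_mk : MeasurePreserving M2.measurableEquivProd.symm
    ((volume : Measure (EuclideanSpace ℝ (Fin 2))).prod circleMeasure) (volume : Measure M2) :=
  ⟨M2.measurableEquivProd.symm.measurable, rfl⟩

@[fun_prop]
theorem M2.measurable_trans : Measurable M2.trans :=
  measurable_fst.comp M2.measurableEquivProd.measurable

@[fun_prop]
theorem M2.measurable_rot : Measurable M2.rot :=
  measurable_snd.comp M2.measurableEquivProd.measurable

theorem M2.integral_eq (f : M2 → ℂ) : ∫ h : M2, f h =
    ∫ p, f ⟨p.1, p.2⟩ ∂(volume : Measure (EuclideanSpace ℝ (Fin 2))).prod circleMeasure :=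
  (M2.measurePreserving_mk.integral_comp M2.measurableEquivProd.symm.measurableEmbedding f).symm

theorem M2.integral_mul (f : EuclideanSpace ℝ (Fin 2) → ℂ) (g : Circle → ℂ) :
    ∫ h : M2, f h.trans * g h.rot = (∫ y, f y) * ∫ u, g u ∂circleMeasure := by
  rw [M2.integral_eq, ← integral_prod_mul]

/-- A Gaussian that dominates the kernels. -/
def gaussDecay (t : ℝ) (h : M2) : ℝ := Real.exp (-‖h.trans‖ ^ 2 / (8 * t))

theorem norm_gaussDecay (t : ℝ) (h : M2) : ‖gaussDecay t h‖ = gaussDecay t h :=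
  Real.norm_of_nonneg (Real.exp_pos _).le

theorem memLp_gaussDecay {t : ℝ} (ht : 0 < t) : MemLp (gaussDecay t) 2 (volume : Measure M2) := by
  have hm : Measurable (gaussDecay t) := by
    unfold gaussDecay
    fun_prop
  rw [memLp_two_iff_integrable_sq_norm hm.aestronglyMeasurable,
    ← M2.measurePreserving_mk.integrable_comp_emb M2.measurableEquivProd.symm.measurableEmbedding]
  have h1 : Integrable (fun y : EuclideanSpace ℝ (Fin 2) => Real.exp (-(1 / (4 * t)) * ‖y‖ ^ 2)) := by
    have hb : 0 < ((1 / (4 * t) : ℝ) : ℂ).re := by rw [Complex.ofReal_re]; positivity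
    have h2 := (GaussianFourier.integrable_cexp_neg_mul_sq_norm_add hb 0
      (0 : EuclideanSpace ℝ (Fin 2))).norm
    refine h2.congr (Filter.Eventually.of_forall fun y => ?_)
    simp only [Complex.norm_exp]
    congr 1
    simp [← Complex.ofReal_pow, ← Complex.ofReal_mul]
  refine (h1.comp_fst circleMeasure).congr (Filter.Eventually.of_forall fun p => ?_)
  change Real.exp (-(1 / (4 * t)) * ‖p.1‖ ^ 2) = ‖Real.exp (-‖p.1‖ ^ 2 / (8 * t))‖ ^ 2
  rw [Real.norm_of_nonneg (Real.exp_pos _).le, ← Real.exp_nat_mul]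
  congr 1
  push_cast
  field_simp
  ring

/-! ### The heat transform -/

/-- The kernel `ψ_t(h⁻¹ g)`, continued in `g` to `ℂ² × ℂ*`. -/
def heatKernelC (t : ℝ) (p : (Fin 2 → ℂ) × ℂ) (h : M2) : ℂ :=
  gaussC t (fun i => p.1 i - h.trans i) * thetaC t (p.2 / h.rot)

theorem norm_rotate (u : Circle) (x : EuclideanSpace ℝ (Fin 2)) : ‖rotate u x‖ = ‖x‖ := by
  have hu : (u : ℂ).re * (u : ℂ).re + (u : ℂ).im * (u : ℂ).im = 1 := by
    rw [← Complex.normSq_apply, Circle.normSq_coe]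
  rw [← sq_eq_sq₀ (norm_nonneg _) (norm_nonneg _), EuclideanSpace.real_norm_sq_eq,
    EuclideanSpace.real_norm_sq_eq, Fin.sum_univ_two, Fin.sum_univ_two]
  simp only [rotate, Matrix.cons_val_zero, Matrix.cons_val_one, PiLp.toLp_apply]
  linear_combination (x 0 ^ 2 + x 1 ^ 2) * hu

/-- The translation part of `h⁻¹g` is a rotation of `g.trans - h.trans`, and the Gaussian sees only
its norm. -/
theorem heatKernel_inv_mul (t : ℝ) (g h : M2) :
    M2.heatKernel t (h⁻¹ * g) = heatKernelC t g.toComplex h := by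
  have h1 : (h⁻¹ * g).trans = rotate h.rot⁻¹ (g.trans - h.trans) := by
    change -rotate h.rot⁻¹ h.trans + rotate h.rot⁻¹ g.trans = _
    rw [sub_eq_add_neg, rotate_add, rotate_neg, add_comm]
  have h2 : (h⁻¹ * g).rot = h.rot⁻¹ * g.rot := rfl
  have h3 : ((h.rot⁻¹ * g.rot : Circle) : ℂ) = (g.rot : ℂ) / h.rot := by
    rw [Circle.coe_mul, Circle.coe_inv, inv_mul_eq_div]
  have h4 : g.toComplex.2 / (h.rot : ℂ) ≠ 0 := div_ne_zero g.rot.coe_ne_zero h.rot.coe_ne_zero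
  rw [M2.heatKernel, h1, h2, norm_rotate, heatKernelC, thetaC, if_neg h4, h3]
  simp only [M2.toComplex]
  congr 1
  rw [gaussC, EuclideanSpace.real_norm_sq_eq, Fin.sum_univ_two, PiLp.sub_apply, PiLp.sub_apply]
  push_cast
  rfl

theorem measurable_heatKernelC {t : ℝ} (ht : 0 < t) (p : (Fin 2 → ℂ) × ℂ) :
    Measurable (heatKernelC t p) := by
  have h1 := (differentiable_gaussC t).continuous.measurable
  have h2 := measurable_thetaC ht
  unfold heatKernelC
  refine (h1.comp (measurable_pi_iff.2 fun i => ?_)).mul (h2.comp ?_)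
  · have : Measurable fun h : M2 => h.trans i := by fun_prop
    fun_prop
  · have : Measurable fun h : M2 => (h.rot : ℂ) := by fun_prop
    fun_prop

theorem norm_heatKernelC_le {t : ℝ} (ht : 0 < t) {R : ℝ} {p : (Fin 2 → ℂ) × ℂ} (hp : p.2 ≠ 0)
    (h0 : ‖p.1‖ ≤ R) (h1 : R⁻¹ ≤ ‖p.2‖) (h2 : ‖p.2‖ ≤ R) (h : M2) :
    ‖heatKernelC t p h‖ ≤ 1 / (4 * Real.pi * t) * Real.exp ((R ^ 2 + R ^ 2) / (4 * t)) *
      (∑' n : ℤ, Real.exp (-(n : ℝ) ^ 2 * t) * (R ^ n + R⁻¹ ^ n)) * gaussDecay t h := by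
  have hpi := Real.pi_pos
  have hu : ‖p.2 / (h.rot : ℂ)‖ = ‖p.2‖ := by rw [norm_div, Circle.norm_coe, div_one]
  have hz : ∀ i, ‖p.1 i‖ ≤ R := fun i => (norm_le_pi_norm p.1 i).trans h0
  have hth := norm_thetaC_le ht (R := R) (div_ne_zero hp h.rot.coe_ne_zero) (by rwa [hu])
    (by rwa [hu])
  have hg : ‖gaussC t fun i => p.1 i - h.trans i‖ ≤ 1 / (4 * Real.pi * t) *
      Real.exp ((R ^ 2 + R ^ 2) / (4 * t)) * gaussDecay t h := by
    refine (norm_gaussC_sub_le ht p.1 h.trans).trans ?_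
    unfold gaussDecay
    gcongr <;> exact hz _
  rw [heatKernelC, norm_mul]
  refine (mul_le_mul hg hth (norm_nonneg _) ((norm_nonneg _).trans hg)).trans (le_of_eq ?_)
  ring

theorem exists_locally_norm_heatKernelC_le {t : ℝ} (ht : 0 < t) {p : (Fin 2 → ℂ) × ℂ}
    (hp : p ∈ complexM2) : ∃ ε > 0, Metric.ball p ε ⊆ complexM2 ∧ ∃ C : ℝ,
      ∀ q ∈ Metric.ball p ε, ∀ h, ‖heatKernelC t q h‖ ≤ C * gaussDecay t h := by
  have hp' : 0 < ‖p.2‖ := norm_pos_iff.2 hp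
  -- Half the distance to `w = 0` keeps the ball away from the puncture. The summand `ε⁻¹` of `R`
  -- below ensures `R⁻¹ ≤ ε`, the lower bound for `‖q.2‖`.
  set ε := ‖p.2‖ / 2 with hε
  have hε0 : 0 < ε := by positivity
  set R := ‖p.1‖ + ‖p.2‖ + ε + ε⁻¹ with hR
  have hR0 : 0 < R := by positivity
  have hεi : 0 < ε⁻¹ := by positivity
  have key : ∀ q ∈ Metric.ball p ε, ‖q.1‖ ≤ R ∧ ε ≤ ‖q.2‖ ∧ ‖q.2‖ ≤ R := by
    intro q hq
    rw [mem_ball_iff_norm] at hq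
    have h1 : ‖q.1 - p.1‖ < ε := (norm_fst_le (q - p)).trans_lt hq
    have h2 : ‖q.2 - p.2‖ < ε := (norm_snd_le (q - p)).trans_lt hq
    have h3 := norm_sub_norm_le q.1 p.1
    have h4 := abs_norm_sub_norm_le q.2 p.2
    have h5 := abs_le.1 h4
    have h6 := norm_nonneg p.1
    refine ⟨by linarith, by linarith, by linarith⟩
  refine ⟨ε, hε0, fun q hq h0 => ?_,
    1 / (4 * Real.pi * t) * Real.exp ((R ^ 2 + R ^ 2) / (4 * t)) *
      (∑' n : ℤ, Real.exp (-(n : ℝ) ^ 2 * t) * (R ^ n + R⁻¹ ^ n)), fun q hq h => ?_⟩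
  · have := (key q hq).2.1
    rw [h0, norm_zero] at this
    linarith
  · obtain ⟨h1, h2, h3⟩ := key q hq
    refine norm_heatKernelC_le ht (R := R) (norm_pos_iff.1 (hε0.trans_le h2)) h1 ?_ h3 h
    refine le_trans ?_ h2
    rw [inv_le_comm₀ hR0 hε0]
    have := norm_nonneg p.1
    linarith

theorem memLp_heatKernelC {t : ℝ} (ht : 0 < t) (p : (Fin 2 → ℂ) × ℂ) :
    MemLp (heatKernelC t p) 2 (volume : Measure M2) := by
  by_cases hp : p.2 = 0
  · have : heatKernelC t p = 0 := by
      funext h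
      simp [heatKernelC, hp, thetaC]
    rw [this]
    exact MemLp.zero
  · obtain ⟨ε, hε, -, C, hC⟩ := exists_locally_norm_heatKernelC_le ht (p := p) hp
    refine (memLp_gaussDecay ht).of_le_mul (c := C) (measurable_heatKernelC ht p).aestronglyMeasurable
      (Filter.Eventually.of_forall fun h => ?_)
    rw [norm_gaussDecay]
    exact hC p (Metric.mem_ball_self hε) h

theorem integrable_mul_heatKernelC {t : ℝ} (ht : 0 < t) (f : Lp ℂ 2 (volume : Measure M2))
    (p : (Fin 2 → ℂ) × ℂ) : Integrable fun h => f h * heatKernelC t p h :=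
  (Lp.memLp f).integrable_mul (memLp_heatKernelC ht p)

/-- The holomorphic extension of `f * ψ_t`. -/
def heatTransform (t : ℝ) (f : Lp ℂ 2 (volume : Measure M2)) (p : (Fin 2 → ℂ) × ℂ) : ℂ :=
  ∫ h, f h * heatKernelC t p h

theorem heatTransform_toComplex (t : ℝ) (f : Lp ℂ 2 (volume : Measure M2)) (g : M2) :
    heatTransform t f g.toComplex = M2.conv f (M2.heatKernel t) g := by
  simp only [heatTransform, M2.conv, heatKernel_inv_mul]

theorem isHolomorphic_heatTransform {t : ℝ} (ht : 0 < t) (f : Lp ℂ 2 (volume : Measure M2)) :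
    IsHolomorphicOnComplexM2 (heatTransform t f) := by
  refine ⟨differentiableOn_integral_of_dominated
    (fun p _ => (integrable_mul_heatKernelC ht f p).aestronglyMeasurable) (fun h => ?_)
    fun p hp => ?_, fun p hp => ?_⟩
  · have h1 : DifferentiableOn ℂ (fun p : (Fin 2 → ℂ) × ℂ => thetaC t (p.2 / h.rot)) complexM2 :=
      (differentiableOn_thetaC ht).comp (by fun_prop) fun p hp =>
        div_ne_zero hp h.rot.coe_ne_zero
    have h2 : Differentiable ℂ fun p : (Fin 2 → ℂ) × ℂ => gaussC t fun i => p.1 i - h.trans i :=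
      (differentiable_gaussC t).comp (by fun_prop)
    exact (h2.differentiableOn.mul h1).const_mul _
  · obtain ⟨ε, hε, hU, C, hC⟩ := exists_locally_norm_heatKernelC_le ht hp
    have hg : MemLp (fun h => C * gaussDecay t h) 2 (volume : Measure M2) :=
      (memLp_gaussDecay ht).const_mul C
    refine ⟨ε, hε, hU, fun h => ‖f h‖ * (C * gaussDecay t h),
      (Lp.memLp f).norm.integrable_mul hg, fun q hq h => ?_⟩
    rw [norm_mul]
    exact mul_le_mul_of_nonneg_left (hC q hq h) (norm_nonneg _)
  · have hp' : p.2 = 0 := not_not.1 hp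
    simp [heatTransform, heatKernelC, hp', thetaC]

/-- The kernel of the heat transform as a vector of `L²(M(2))`. -/
def kernelVec {t : ℝ} (ht : 0 < t) (p : (Fin 2 → ℂ) × ℂ) : Lp ℂ 2 (volume : Measure M2) :=
  (memLp_heatKernelC ht p).star.toLp _

/-- Makes linearity and the continuity of point evaluations in `f` immediate. -/
theorem heatTransform_eq_inner {t : ℝ} (ht : 0 < t) (f : Lp ℂ 2 (volume : Measure M2))
    (p : (Fin 2 → ℂ) × ℂ) : heatTransform t f p = inner ℂ (kernelVec ht p) f := by
  rw [L2.inner_def, heatTransform]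
  refine integral_congr_ae ?_
  filter_upwards [(memLp_heatKernelC ht p).star.coeFn_toLp] with h hh
  rw [kernelVec, hh]
  simp

/-- The Gaussian about the conjugate of `q ∈ ℂ²` times a character of the circle. -/
def testFun (t : ℝ) (i : (Fin 2 → ℂ) × ℤ) (h : M2) : ℂ :=
  gaussC t (fun j => h.trans j - conj (i.1 j)) * (h.rot : ℂ) ^ i.2

theorem memLp_testFun {t : ℝ} (ht : 0 < t) (i : (Fin 2 → ℂ) × ℤ) :
    MemLp (testFun t i) 2 (volume : Measure M2) := by
  have hm : Measurable (testFun t i) := by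
    unfold testFun
    refine ((differentiable_gaussC t).continuous.measurable.comp
      (measurable_pi_iff.2 fun j => ?_)).mul (Measurable.pow_const ?_ _)
    · have : Measurable fun h : M2 => h.trans j := by fun_prop
      fun_prop
    · fun_prop
  refine (memLp_gaussDecay ht).of_le_mul (c := 1 / (4 * Real.pi * t) *
    Real.exp ((‖conj (i.1 0)‖ ^ 2 + ‖conj (i.1 1)‖ ^ 2) / (4 * t))) hm.aestronglyMeasurable
    (Filter.Eventually.of_forall fun h => ?_)
  rw [testFun, norm_mul, norm_zpow, Circle.norm_coe, one_zpow, mul_one, norm_gaussDecay,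
    gaussC_sub_comm]
  exact norm_gaussC_sub_le ht (fun j => conj (i.1 j)) h.trans

/-- `testFun` as a vector of `L²(M(2))`. -/
def testVec {t : ℝ} (ht : 0 < t) (i : (Fin 2 → ℂ) × ℤ) : Lp ℂ 2 (volume : Measure M2) :=
  (memLp_testFun ht i).toLp _

/-- The heat transform of `testFun`. -/
def testHol (t : ℝ) (i : (Fin 2 → ℂ) × ℤ) (p : (Fin 2 → ℂ) × ℂ) : ℂ :=
  gaussC (2 * t) (fun j => p.1 j - conj (i.1 j)) *
    if p.2 = 0 then 0 else (Real.exp (-(i.2 : ℝ) ^ 2 * t) : ℂ) * p.2 ^ i.2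

theorem heatTransform_testVec {t : ℝ} (ht : 0 < t) (i : (Fin 2 → ℂ) × ℤ) :
    heatTransform t (testVec ht i) = testHol t i := by
  funext p
  have h1 : heatTransform t (testVec ht i) p = ∫ h : M2,
      (gaussC t (fun j => h.trans j - conj (i.1 j)) * gaussC t (fun j => p.1 j - h.trans j)) *
      ((h.rot : ℂ) ^ i.2 * thetaC t (p.2 / h.rot)) := by
    refine integral_congr_ae ?_
    filter_upwards [(memLp_testFun ht i).coeFn_toLp] with h hh
    rw [testVec, hh, testFun, heatKernelC]
    ring
  rw [h1, M2.integral_mul (fun y => gaussC t (fun j => y j - conj (i.1 j)) *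
    gaussC t (fun j => p.1 j - y j)) fun u => (u : ℂ) ^ i.2 * thetaC t (p.2 / u),
    integral_gaussC_mul_gaussC ht, testHol]
  congr 1
  split_ifs with hp
  · simp [hp, thetaC]
  · exact integral_zpow_mul_thetaC ht _ hp

/-- Conjugation moves the centre of the first Gaussian from `conj q` to `q`, and the semigroup law
applies again. -/
theorem inner_testVec {t : ℝ} (ht : 0 < t) (i j : (Fin 2 → ℂ) × ℤ) :
    inner ℂ (testVec ht i) (testVec ht j) =
      if i.2 = j.2 then gaussC (2 * t) fun k => i.1 k - conj (j.1 k) else 0 := by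
  have h1 : inner ℂ (testVec ht i) (testVec ht j) = ∫ h : M2,
      (gaussC t (fun k => h.trans k - conj (j.1 k)) * gaussC t (fun k => i.1 k - h.trans k)) *
      (h.rot : ℂ) ^ (j.2 - i.2) := by
    rw [L2.inner_def]
    refine integral_congr_ae ?_
    filter_upwards [(memLp_testFun ht i).coeFn_toLp, (memLp_testFun ht j).coeFn_toLp] with h hi hj
    rw [testVec, testVec, hi, hj, RCLike.inner_apply, testFun, testFun, map_mul, conj_gaussC,
      map_zpow₀, ← Circle.coe_inv_eq_conj, Circle.coe_inv, inv_zpow,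
      zpow_sub₀ h.rot.coe_ne_zero, gaussC_sub_comm t i.1]
    simp only [map_sub, Complex.conj_ofReal, Complex.conj_conj]
    ring
  rw [h1, M2.integral_mul (fun y => gaussC t (fun k => y k - conj (j.1 k)) *
    gaussC t (fun k => i.1 k - y k)) fun u => (u : ℂ) ^ (j.2 - i.2),
    integral_gaussC_mul_gaussC ht, integral_circle_zpow]
  by_cases h : i.2 = j.2
  · simp [h]
  · rw [if_neg h, if_neg (by omega), mul_zero]

/-- The functions `testFun` are total in `L²(M(2))`. -/
theorem eq_zero_of_inner_testVec_eq_zero {t : ℝ} (ht : 0 < t) (f : Lp ℂ 2 (volume : Measure M2))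
    (hf : ∀ i, inner ℂ (testVec ht i) f = 0) : f = 0 := by
  let c : EuclideanSpace ℝ (Fin 2) → ℤ → EuclideanSpace ℝ (Fin 2) × Circle → ℂ := fun ξ n p =>
    Complex.exp ((ξ 0 * p.1 0 + ξ 1 * p.1 1 : ℝ) * Complex.I) * (p.2 : ℂ) ^ n
  have hcc : ∀ ξ n, Continuous (c ξ n) := by
    intro ξ n
    refine Continuous.mul (by fun_prop) ?_
    exact Continuous.zpow₀ (by fun_prop) n fun p => Or.inl p.2.coe_ne_zero
  have hcn : ∀ ξ n p, ‖c ξ n p‖ ≤ 1 := by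
    intro ξ n p
    simp only [c]
    rw [norm_mul, Complex.norm_exp_ofReal_mul_I, norm_zpow, Circle.norm_coe, one_zpow, mul_one]
  let S : Submonoid (BoundedContinuousFunction (EuclideanSpace ℝ (Fin 2) × Circle) ℂ) :=
    { carrier := {χ | ∃ ξ n, ∀ p, χ p = c ξ n p}
      one_mem' := ⟨0, 0, fun p => by simp [c]⟩
      mul_mem' := by
        rintro χ η ⟨ξ, n, h1⟩ ⟨ζ, m, h2⟩
        refine ⟨ξ + ζ, n + m, fun p => ?_⟩
        rw [BoundedContinuousFunction.mul_apply, h1, h2]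
        simp only [c]
        rw [zpow_add₀ p.2.coe_ne_zero, mul_mul_mul_comm, ← Complex.exp_add]
        congr 2
        simp only [PiLp.add_apply]
        push_cast
        ring }
  have hstar : ∀ χ ∈ S, star χ ∈ S := by
    rintro χ ⟨ξ, n, h1⟩
    refine ⟨-ξ, -n, fun p => ?_⟩
    rw [BoundedContinuousFunction.star_apply, h1]
    simp only [c]
    rw [RCLike.star_def, map_mul, ← Complex.exp_conj, map_zpow₀, ← Circle.coe_inv_eq_conj,
      Circle.coe_inv, inv_zpow', map_mul, Complex.conj_I, Complex.conj_ofReal]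
    congr 2
    simp only [PiLp.neg_apply]
    push_cast
    ring
  have hmem : ∀ ξ n, BoundedContinuousFunction.ofNormedAddCommGroup (c ξ n) (hcc ξ n) 1 (hcn ξ n) ∈ S :=
    fun ξ n => ⟨ξ, n, fun p => rfl⟩
  have hsep : ∀ p q : EuclideanSpace ℝ (Fin 2) × Circle, p ≠ q → ∃ χ ∈ S, χ p ≠ χ q := by
    intro p q hpq
    by_cases h2 : p.2 = q.2
    · have h1 : p.1 - q.1 ≠ 0 := fun h => hpq (Prod.ext (sub_eq_zero.1 h) h2)
      have hN : 0 < ‖p.1 - q.1‖ ^ 2 := by positivity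
      set N := ‖p.1 - q.1‖ ^ 2 with hNdef
      -- The frequency is scaled so that the phases at `p` and `q` differ by exactly 1, and `sin 1 ≠
      -- 0`.
      refine ⟨_, hmem ((1 / N) • (p.1 - q.1)) 0, fun h => ?_⟩
      change c _ _ _ = c _ _ _ at h
      simp only [c, zpow_zero, mul_one] at h
      have h3 := congrArg (fun z => z / Complex.exp ((((1 / N) • (p.1 - q.1)) 0 * q.1 0 +
        ((1 / N) • (p.1 - q.1)) 1 * q.1 1 : ℝ) * Complex.I)) h
      simp only at h3
      rw [div_self (Complex.exp_ne_zero _), ← Complex.exp_sub] at h3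
      have h4 : ((((1 / N) • (p.1 - q.1)) 0 * p.1 0 + ((1 / N) • (p.1 - q.1)) 1 * p.1 1 : ℝ) : ℂ) *
          Complex.I - ((((1 / N) • (p.1 - q.1)) 0 * q.1 0 +
          ((1 / N) • (p.1 - q.1)) 1 * q.1 1 : ℝ) : ℂ) * Complex.I = (1 : ℝ) * Complex.I := by
        rw [← sub_mul, ← Complex.ofReal_sub]
        congr 2
        have : N = (p.1 0 - q.1 0) ^ 2 + (p.1 1 - q.1 1) ^ 2 := by
          rw [hNdef, EuclideanSpace.real_norm_sq_eq, Fin.sum_univ_two]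
          simp
        simp only [PiLp.smul_apply, PiLp.sub_apply, smul_eq_mul]
        field_simp
        rw [this]
        ring
      rw [h4] at h3
      have h5 := congrArg Complex.im h3
      rw [Complex.exp_ofReal_mul_I_im, Complex.one_im] at h5
      exact (Real.sin_pos_of_pos_of_lt_pi one_pos (by linarith [Real.pi_gt_three])).ne' h5
    · refine ⟨_, hmem 0 1, fun h => h2 ?_⟩
      change c _ _ _ = c _ _ _ at h
      exact Circle.ext (by simpa [c] using h)
  let π := (volume : Measure (EuclideanSpace ℝ (Fin 2))).prod circleMeasure
  -- The Gaussian factor makes the square integrable `f` integrable; it has no zeros, so `f`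
  -- vanishes where `g` does.
  let g : EuclideanSpace ℝ (Fin 2) × Circle → ℂ := fun p =>
    gaussC t (fun j => p.1 j) * f ⟨p.1, p.2⟩
  have hgi : Integrable g π := by
    have h1 := (memLp_testFun ht (0, 0)).integrable_mul (Lp.memLp f)
    have h2 := (M2.measurePreserving_mk.integrable_comp_emb
      M2.measurableEquivProd.symm.measurableEmbedding).2 h1
    refine h2.congr (Filter.Eventually.of_forall fun p => ?_)
    simp [g, testFun, M2.measurableEquivProd]
  have hg0 : g =ᵐ[π] 0 := by
    refine ae_eq_zero_of_integral_mul_eq_zero hgi S hstar hsep ?_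
    rintro χ ⟨ξ, n, hχ⟩
    -- With `q = 2itξ` the conjugated Gaussian is `e^{t|ξ|²} e^{iξ·x}` times the Gaussian at the
    -- origin. The sign of `n` undoes the conjugation of the character.
    have hq := hf (fun j => 2 * t * Complex.I * ξ j, -n)
    rw [L2.inner_def] at hq
    have e : ∀ᵐ h : M2, inner ℂ (testVec ht (fun j => 2 * t * Complex.I * ξ j, -n) h) (f h) =
        Complex.exp (t * (ξ 0 ^ 2 + ξ 1 ^ 2)) *
          (c ξ n (h.trans, h.rot) * (gaussC t (fun j => h.trans j) * f h)) := by
      filter_upwards [(memLp_testFun ht (fun j => 2 * t * Complex.I * ξ j, -n)).coeFn_toLp] with h hh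
      rw [testVec, hh, RCLike.inner_apply, testFun, map_mul, conj_gaussC, map_zpow₀,
        ← Circle.coe_inv_eq_conj, Circle.coe_inv, inv_zpow', neg_neg]
      simp only [map_sub, Complex.conj_ofReal, Complex.conj_conj, c, gaussC]
      have ht' : (t : ℂ) ≠ 0 := by exact_mod_cast ht.ne'
      have e2 : Complex.exp (-((h.trans 0 - 2 * t * Complex.I * ξ 0) ^ 2 +
          (h.trans 1 - 2 * t * Complex.I * ξ 1) ^ 2) / (4 * t)) =
          Complex.exp (t * (ξ 0 ^ 2 + ξ 1 ^ 2)) *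
          Complex.exp ((ξ 0 * h.trans 0 + ξ 1 * h.trans 1 : ℝ) * Complex.I) *
          Complex.exp (-((h.trans 0 : ℂ) ^ 2 + (h.trans 1 : ℂ) ^ 2) / (4 * t)) := by
        rw [← Complex.exp_add, ← Complex.exp_add]
        congr 1
        push_cast
        field_simp
        ring_nf
        simp only [Complex.I_sq]
        ring
      rw [e2]
      ring
    rw [integral_congr_ae e, integral_const_mul, mul_eq_zero_iff_left (Complex.exp_ne_zero _),
      M2.integral_eq] at hq
    simp_rw [hχ]
    exact hq
  rw [Lp.eq_zero_iff_ae_eq_zero]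
  have h3 : ∀ᵐ h : M2, g (h.trans, h.rot) = 0 := by
    rw [← M2.measurePreserving_mk.map_eq]
    exact (M2.measurableEquivProd.symm.measurableEmbedding.ae_map_iff).2 hg0
  filter_upwards [h3] with h hh
  refine (mul_eq_zero.1 hh).resolve_left (mul_ne_zero ?_ (Complex.exp_ne_zero _))
  have := Real.pi_pos
  exact Complex.ofReal_ne_zero.2 (by positivity)

/-! ### The reproducing property in the translation variable -/

theorem measurePreserving_circle_mul (u : Circle) :
    MeasurePreserving (fun w : ℂ => (u : ℂ) * w) volume volume :=
  (rotation u).measurePreserving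

theorem measurePreserving_circle_smul (u : Circle) :
    MeasurePreserving (fun z : Fin 2 → ℂ => (u : ℂ) • z) volume volume :=
  volume_preserving_pi fun _ => measurePreserving_circle_mul u

/-- The Gaussian `e^{-|z|²/4t}` on `ℂ²`. -/
def gaussAbs (t : ℝ) (z : Fin 2 → ℂ) : ℝ := Real.exp (-(‖z 0‖ ^ 2 + ‖z 1‖ ^ 2) / (4 * t))

theorem gaussAbs_eq_prod (t : ℝ) (z : Fin 2 → ℂ) :
    gaussAbs t z = ∏ i, Real.exp (-(1 / (4 * t)) * ‖z i‖ ^ 2) := by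
  rw [gaussAbs, Fin.prod_univ_two, ← Real.exp_add]
  congr 1
  ring

theorem integrable_gaussAbs {t : ℝ} (ht : 0 < t) : Integrable (gaussAbs t) := by
  have h1 : Integrable fun z : ℂ => Real.exp (-(1 / (4 * t)) * ‖z‖ ^ 2) := by
    have hb : 0 < ((1 / (4 * t) : ℝ) : ℂ).re := by rw [Complex.ofReal_re]; positivity
    have h2 := (GaussianFourier.integrable_cexp_neg_mul_sq_norm_add hb 0 (0 : ℂ)).norm
    refine h2.congr (Filter.Eventually.of_forall fun y => ?_)
    simp only [Complex.norm_exp]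
    congr 1
    simp [← Complex.ofReal_pow, ← Complex.ofReal_mul]
  refine (Integrable.fintype_prod (f := fun (_ : Fin 2) (z : ℂ) =>
    Real.exp (-(1 / (4 * t)) * ‖z‖ ^ 2)) fun _ => h1).congr
    (Filter.Eventually.of_forall fun z => (gaussAbs_eq_prod t z).symm)

theorem integral_gaussAbs {t : ℝ} (ht : 0 < t) : ∫ z, gaussAbs t z = (4 * Real.pi * t) ^ 2 := by
  have h1 : ∫ z : ℂ, Real.exp (-(1 / (4 * t)) * ‖z‖ ^ 2) = 4 * Real.pi * t := by
    rw [GaussianFourier.integral_rexp_neg_mul_sq_norm (by positivity), Complex.finrank_real_complex]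
    norm_num
    field_simp
  simp_rw [gaussAbs_eq_prod]
  rw [integral_fintype_prod_volume_eq_pow (fun z : ℂ => Real.exp (-(1 / (4 * t)) * ‖z‖ ^ 2)), h1]
  simp

/-- The density of `μ`. -/
def muDensity (t : ℝ) (z : Fin 2 → ℂ) : ℝ :=
  1 / (2 * Real.pi * t) * Real.exp (-((z 0).im ^ 2 + (z 1).im ^ 2) / (2 * t))

theorem measurable_muDensity (t : ℝ) : Measurable (muDensity t) := by
  unfold muDensity; fun_prop

theorem muDensity_nonneg {t : ℝ} (ht : 0 < t) (z : Fin 2 → ℂ) : 0 ≤ muDensity t z := by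
  have := Real.pi_pos
  unfold muDensity; positivity

theorem integrable_mu_iff {t : ℝ} (ht : 0 < t) {E : Type*} [NormedAddCommGroup E] [NormedSpace ℝ E]
    {f : (Fin 2 → ℂ) → E} :
    Integrable f (muMeasure t) ↔ Integrable fun z => muDensity t z • f z := by
  have h := integrable_withDensity_iff_integrable_smul' (μ := (volume : Measure (Fin 2 → ℂ)))
    (f := fun z => ENNReal.ofReal (muDensity t z)) (g := f)
    (measurable_muDensity t).ennreal_ofReal (by simp)
  simp_rw [ENNReal.toReal_ofReal (muDensity_nonneg ht _)] at h
  exact h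

theorem integral_mu {t : ℝ} (ht : 0 < t) (f : (Fin 2 → ℂ) → ℂ) :
    ∫ z, f z ∂muMeasure t = ∫ z, muDensity t z • f z := by
  have h := integral_withDensity_eq_integral_toReal_smul (μ := (volume : Measure (Fin 2 → ℂ)))
    (f := fun z => ENNReal.ofReal (muDensity t z))
    (measurable_muDensity t).ennreal_ofReal (by simp) f
  simp_rw [ENNReal.toReal_ofReal (muDensity_nonneg ht _)] at h
  exact h

/-- Writing `(Im w)² = -(w - conj w)²/4`, the exponent becomes `-|z - q|²/4t` plus a polynomial
holomorphic in `z` that vanishes at `z = q`. This is what makes the mean value property applicable.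
-/
theorem muDensity_mul_conj_gaussC {t : ℝ} (ht : 0 < t) (q z : Fin 2 → ℂ) :
    (muDensity t z : ℂ) * conj (gaussC (2 * t) fun i => z i - conj (q i)) =
      (1 / (4 * Real.pi * t) ^ 2 : ℝ) * (gaussAbs t (fun i => z i - q i) *
        Complex.exp ((z 0 ^ 2 + z 1 ^ 2 - q 0 ^ 2 - q 1 ^ 2) / (8 * t) -
          (conj (q 0) * (z 0 - q 0) + conj (q 1) * (z 1 - q 1)) / (4 * t))) := by
  have ht' : (t : ℂ) ≠ 0 := by exact_mod_cast ht.ne'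
  have hpi' : (Real.pi : ℂ) ≠ 0 := by exact_mod_cast Real.pi_ne_zero
  have him : ∀ w : ℂ, (w.im : ℂ) ^ 2 = -(w - conj w) ^ 2 / 4 := by
    intro w
    rw [Complex.sub_conj, mul_pow, Complex.I_sq]
    push_cast
    ring
  have habs : ∀ w : ℂ, (‖w‖ : ℂ) ^ 2 = w * conj w := fun w => (Complex.mul_conj' w).symm
  rw [conj_gaussC, muDensity, gaussAbs, gaussC]
  push_cast
  simp only [him, habs, map_sub, Complex.conj_conj]
  rw [mul_mul_mul_comm, ← Complex.exp_add, ← Complex.exp_add]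
  congr 1
  · field_simp
    norm_num
  · congr 1
    field_simp
    ring

/-- The mean value property on the complex line through `q` in the direction `z`. -/
theorem integral_circle_of_differentiable {G : (Fin 2 → ℂ) → ℂ} (hG : Differentiable ℂ G)
    (q z : Fin 2 → ℂ) : ∫ u : Circle, G (q + (u : ℂ) • z) ∂circleMeasure = G q := by
  have hd : Differentiable ℂ fun s : ℂ => G (q + s • z) := hG.comp (by fun_prop)
  have h1 := integral_circleMeasure_mul (fun s => G (q + s • z)) 1
    ((hd.continuous.comp (by fun_prop : Continuous fun u : Circle => (u : ℂ) * 1)).measurable)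
  simp only [mul_one] at h1
  rw [h1, hd.diffContOnCl.circleAverage]
  simp

/-- The Gaussians reproduce the values of entire functions on `ℂ²`. -/
theorem integral_conj_gaussC_mul {t : ℝ} (ht : 0 < t) (q : Fin 2 → ℂ) {F : (Fin 2 → ℂ) → ℂ}
    (hF : Differentiable ℂ F) (hi : Integrable
      (fun z => conj (gaussC (2 * t) fun i => z i - conj (q i)) * F z) (muMeasure t)) :
    ∫ z, conj (gaussC (2 * t) fun i => z i - conj (q i)) * F z ∂muMeasure t = F q := by
  have hpi := Real.pi_pos
  -- `G` collects the holomorphic factors and agrees with `F` at `q`. The remaining factor is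
  -- invariant under rotations `z ↦ q + u(z - q)`, and its total mass `(4πt)²` cancels the constant.
  let G : (Fin 2 → ℂ) → ℂ := fun z => Complex.exp ((z 0 ^ 2 + z 1 ^ 2 - q 0 ^ 2 - q 1 ^ 2) / (8 * t) -
    (conj (q 0) * (z 0 - q 0) + conj (q 1) * (z 1 - q 1)) / (4 * t)) * F z
  have hG : Differentiable ℂ G := by
    refine Differentiable.mul ?_ hF
    fun_prop
  have hGq : G q = F q := by simp [G]
  have e : (fun z => muDensity t z • (conj (gaussC (2 * t) fun i => z i - conj (q i)) * F z)) =
      fun z => ((1 / (4 * Real.pi * t) ^ 2 : ℝ) : ℂ) * (gaussAbs t (z - q) * G z) := by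
    funext z
    rw [Complex.real_smul, ← mul_assoc, muDensity_mul_conj_gaussC ht]
    have : (gaussAbs t fun i => z i - q i) = gaussAbs t (z - q) := rfl
    rw [this]
    simp only [G]
    ring
  rw [integrable_mu_iff ht, e] at hi
  rw [integral_mu ht, e, integral_const_mul]
  have hc : ((1 / (4 * Real.pi * t) ^ 2 : ℝ) : ℂ) ≠ 0 := Complex.ofReal_ne_zero.2 (by positivity)
  have hi2 : Integrable fun z => (gaussAbs t (z - q) : ℂ) * G z := by
    refine (hi.const_mul (((1 / (4 * Real.pi * t) ^ 2 : ℝ) : ℂ)⁻¹)).congr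
      (Filter.Eventually.of_forall fun z => ?_)
    simp only
    rw [inv_mul_cancel_left₀ hc]
  have hi3 : Integrable fun z => (gaussAbs t z : ℂ) * G (q + z) := by
    refine (hi2.comp_add_left q).congr (Filter.Eventually.of_forall fun z => ?_)
    simp only [add_sub_cancel_left]
  have h1 : ∫ z, (gaussAbs t (z - q) : ℂ) * G z = ∫ z, (gaussAbs t z : ℂ) * G (q + z) := by
    rw [← integral_add_left_eq_self _ q]
    simp only [add_sub_cancel_left]
  have h2 : ∀ z, ∫ u : Circle, (gaussAbs t ((u : ℂ) • z) : ℂ) * G (q + (u : ℂ) • z) ∂circleMeasure =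
      gaussAbs t z * F q := by
    intro z
    have : ∀ u : Circle, gaussAbs t ((u : ℂ) • z) = gaussAbs t z := by
      intro u
      have hn : ∀ i, ‖((u : ℂ) • z) i‖ = ‖z i‖ := fun i => by
        rw [Pi.smul_apply, norm_smul, Circle.norm_coe, one_mul]
      rw [gaussAbs, hn, hn, gaussAbs]
    simp_rw [this]
    rw [integral_const_mul, integral_circle_of_differentiable hG, hGq]
  rw [h1, integral_eq_integral_circle_average (ρ := fun (u : Circle) (z : Fin 2 → ℂ) => (u : ℂ) • z)
    (by simp only [Function.uncurry_def]; fun_prop) measurePreserving_circle_smul hi3]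
  simp_rw [h2]
  rw [integral_mul_const, integral_complex_ofReal, integral_gaussAbs ht, ← mul_assoc,
    ← Complex.ofReal_mul, one_div_mul_cancel (by positivity), Complex.ofReal_one, one_mul]

theorem memLp_gaussC_mu {t : ℝ} (ht : 0 < t) (q : Fin 2 → ℂ) :
    MemLp (fun z : Fin 2 → ℂ => gaussC (2 * t) fun i => z i - conj (q i)) 2 (muMeasure t) := by
  have hpi := Real.pi_pos
  have hc : Continuous fun z : Fin 2 → ℂ => gaussC (2 * t) fun i => z i - conj (q i) :=
    (differentiable_gaussC _).continuous.comp (by fun_prop)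
  rw [memLp_two_iff_integrable_sq_norm hc.aestronglyMeasurable, integrable_mu_iff ht]
  refine (((integrable_gaussAbs ht).comp_sub_right q).const_mul
    (1 / (2 * Real.pi * t) * (1 / (4 * Real.pi * (2 * t))) ^ 2 *
      Real.exp (((q 0).im ^ 2 + (q 1).im ^ 2) / (2 * t)))).congr
    (Filter.Eventually.of_forall fun z => ?_)
  simp only [smul_eq_mul, muDensity, norm_gaussC (show 0 < 2 * t by positivity), gaussAbs]
  -- The squared kernel times the density of `μ` is a multiple of `gaussAbs` centred at `q`.
  have key : Real.exp (((q 0).im ^ 2 + (q 1).im ^ 2) / (2 * t)) *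
      Real.exp (-(‖(z - q) 0‖ ^ 2 + ‖(z - q) 1‖ ^ 2) / (4 * t)) =
      Real.exp (-((z 0).im ^ 2 + (z 1).im ^ 2) / (2 * t)) *
      Real.exp (-((z 0 - conj (q 0)).re ^ 2 + (z 1 - conj (q 1)).re ^ 2 -
        (z 0 - conj (q 0)).im ^ 2 - (z 1 - conj (q 1)).im ^ 2) / (4 * (2 * t))) ^ 2 := by
    rw [← Real.exp_nat_mul, ← Real.exp_add, ← Real.exp_add]
    congr 1
    simp only [Pi.sub_apply, Complex.sq_norm, Complex.normSq_apply, Complex.sub_re, Complex.sub_im,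
      Complex.conj_re, Complex.conj_im]
    push_cast
    field_simp
    ring
  linear_combination (1 / (2 * Real.pi * t) * (1 / (4 * Real.pi * (2 * t))) ^ 2) * key

/-! ### The reproducing property in the rotation variable -/

theorem ae_ne_zero_nu (t : ℝ) : ∀ᵐ w ∂nuMeasure t, w ≠ 0 :=
  (withDensity_absolutelyContinuous _ _).ae_le (ae_restrict_mem (measurableSet_singleton 0).compl)

theorem measurePreserving_circle_mul_nu (t : ℝ) (u : Circle) :
    MeasurePreserving (fun w : ℂ => (u : ℂ) * w) (nuMeasure t) (nuMeasure t) := by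
  have h0 : (fun w : ℂ => (u : ℂ) * w) ⁻¹' {0}ᶜ = {0}ᶜ := by
    ext w
    simp
  have h1 := (measurePreserving_circle_mul u).restrict_preimage
    (measurableSet_singleton (0 : ℂ)).compl
  rw [h0] at h1
  refine ⟨h1.measurable, Measure.ext fun s hs => ?_⟩
  rw [Measure.map_apply h1.measurable hs, nuMeasure, withDensity_apply _ (h1.measurable hs),
    withDensity_apply _ hs, ← h1.setLIntegral_comp_preimage hs (by fun_prop)]
  simp only [norm_mul, Circle.norm_coe, one_mul]

theorem lintegral_exp_quadratic {t : ℝ} (ht : 0 < t) (b : ℝ) :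
    ∫⁻ s : ℝ, ENNReal.ofReal (Real.exp (-s ^ 2 / (2 * t) + 2 * b * s)) =
      ENNReal.ofReal (Real.sqrt (2 * Real.pi * t) * Real.exp (2 * b ^ 2 * t)) := by
  have e : ∀ s : ℝ, Real.exp (-s ^ 2 / (2 * t) + 2 * b * s) =
      Real.exp (2 * b ^ 2 * t) * Real.exp (-(1 / (2 * t)) * (s - 2 * b * t) ^ 2) := by
    intro s
    rw [← Real.exp_add]
    congr 1
    field_simp
    ring
  have hi : Integrable fun s : ℝ => Real.exp (-(1 / (2 * t)) * (s - 2 * b * t) ^ 2) :=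
    (integrable_exp_neg_mul_sq (show 0 < 1 / (2 * t) by positivity)).comp_sub_right (2 * b * t)
  simp_rw [e]
  rw [← ofReal_integral_eq_lintegral_ofReal (hi.const_mul _)
    (Filter.Eventually.of_forall fun s => by positivity), integral_const_mul,
    integral_sub_right_eq_self (fun s : ℝ => Real.exp (-(1 / (2 * t)) * s ^ 2)) (2 * b * t),
    integral_gaussian, mul_comm]
  congr 3
  field_simp

/-- In polar coordinates with `r = e^s` the two Jacobians cancel `|w|⁻²`, and a Gaussian integral
with linear term `2ns` remains. The lower integral yields integrability together with the value. -/
theorem lintegral_norm_zpow_nu {t : ℝ} (ht : 0 < t) (n : ℤ) :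
    ∫⁻ w, ENNReal.ofReal ((‖w‖ ^ n) ^ 2) ∂nuMeasure t =
      ENNReal.ofReal (Real.exp (2 * (n : ℝ) ^ 2 * t)) := by
  have hpi := Real.pi_pos
  let φ : ℝ → ℝ := fun r => 1 / (2 * Real.pi) * (1 / Real.sqrt (2 * Real.pi * t)) *
    (Real.exp (-(Real.log r) ^ 2 / (2 * t)) / r ^ 2) * (r ^ n) ^ 2
  have hφm : Measurable φ := by
    have : Measurable fun r : ℝ => r ^ n := Measurable.pow_const measurable_id n
    fun_prop
  have h1 : ∫⁻ w, ENNReal.ofReal ((‖w‖ ^ n) ^ 2) ∂nuMeasure t = ∫⁻ w : ℂ, ENNReal.ofReal (φ ‖w‖) := by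
    have hm : Measurable fun w : ℂ => ENNReal.ofReal ((‖w‖ ^ n) ^ 2) := by
      have : Measurable fun w : ℂ => ‖w‖ ^ n := Measurable.pow_const measurable_norm n
      fun_prop
    rw [nuMeasure, lintegral_withDensity_eq_lintegral_mul _ (by fun_prop) hm,
      restrict_compl_singleton]
    refine lintegral_congr fun w => ?_
    rw [Pi.mul_apply, ← ENNReal.ofReal_mul (by positivity)]
  have h2 : ∫⁻ w : ℂ, ENNReal.ofReal (φ ‖w‖) =
      ENNReal.ofReal (2 * Real.pi) * ∫⁻ r in Ioi (0 : ℝ), ENNReal.ofReal (r * φ r) := by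
    rw [← Complex.lintegral_comp_polarCoord_symm, polarCoord_target, Measure.volume_eq_prod,
      ← Measure.prod_restrict]
    have h3 : ∀ᵐ p : ℝ × ℝ ∂((volume.restrict (Ioi (0 : ℝ))).prod
        (volume.restrict (Ioo (-Real.pi) Real.pi))),
        ENNReal.ofReal p.1 • ENNReal.ofReal (φ ‖Complex.polarCoord.symm p‖) =
          ENNReal.ofReal (p.1 * φ p.1) := by
      rw [Measure.prod_restrict]
      filter_upwards [ae_restrict_mem (measurableSet_Ioi.prod measurableSet_Ioo)] with p hp
      have hp0 : 0 < p.1 := hp.1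
      rw [Complex.norm_polarCoord_symm, abs_of_pos hp0, smul_eq_mul, ENNReal.ofReal_mul hp0.le]
    rw [lintegral_congr_ae h3, lintegral_prod _ (by fun_prop)]
    simp only [lintegral_const, Measure.restrict_apply_univ, Real.volume_Ioo]
    rw [lintegral_mul_const _ (by fun_prop), mul_comm]
    congr 2
    ring
  have h4 : ∫⁻ r in Ioi (0 : ℝ), ENNReal.ofReal (r * φ r) =
      ∫⁻ s : ℝ, ENNReal.ofReal (1 / (2 * Real.pi) * (1 / Real.sqrt (2 * Real.pi * t))) *
        ENNReal.ofReal (Real.exp (-s ^ 2 / (2 * t) + 2 * n * s)) := by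
    have himg : Real.exp '' univ = Ioi 0 := by rw [image_univ, Real.range_exp]
    rw [← himg, lintegral_image_eq_lintegral_abs_deriv_mul MeasurableSet.univ
      (fun s _ => (Real.hasDerivAt_exp s).hasDerivWithinAt) Real.exp_injective.injOn,
      Measure.restrict_univ]
    refine lintegral_congr fun s => ?_
    rw [abs_of_pos (Real.exp_pos s), ← ENNReal.ofReal_mul (Real.exp_pos s).le,
      ← ENNReal.ofReal_mul (by positivity)]
    congr 1
    simp only [φ, Real.log_exp]
    have e1 : (Real.exp s ^ n) ^ 2 = Real.exp (2 * n * s) := by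
      rw [← Real.rpow_intCast, ← Real.exp_mul, ← Real.exp_nat_mul]
      congr 1
      push_cast
      ring
    rw [e1, Real.exp_add]
    field_simp
  rw [h1, h2, h4, lintegral_const_mul _ (by fun_prop), lintegral_exp_quadratic ht,
    ← ENNReal.ofReal_mul (by positivity), ← ENNReal.ofReal_mul (by positivity)]
  congr 1
  have : Real.sqrt (2 * Real.pi * t) ≠ 0 := by positivity
  field_simp

theorem integrable_norm_zpow_nu {t : ℝ} (ht : 0 < t) (n : ℤ) :
    Integrable (fun w : ℂ => (‖w‖ ^ n) ^ 2) (nuMeasure t) := by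
  have hm : Measurable fun w : ℂ => ‖w‖ ^ n := Measurable.pow_const measurable_norm n
  refine ⟨(hm.pow_const 2).aestronglyMeasurable, ?_⟩
  rw [hasFiniteIntegral_iff_ofReal (Filter.Eventually.of_forall fun w => by positivity),
    lintegral_norm_zpow_nu ht]
  exact ENNReal.ofReal_lt_top

theorem integral_norm_zpow_nu {t : ℝ} (ht : 0 < t) (n : ℤ) :
    ∫ w : ℂ, (‖w‖ ^ n) ^ 2 ∂nuMeasure t = Real.exp (2 * (n : ℝ) ^ 2 * t) := by
  rw [integral_eq_lintegral_of_nonneg_ae (Filter.Eventually.of_forall fun w => by positivity)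
    (integrable_norm_zpow_nu ht n).aestronglyMeasurable, lintegral_norm_zpow_nu ht,
    ENNReal.toReal_ofReal (Real.exp_pos _).le]

instance (t : ℝ) : SFinite (nuMeasure t) := by
  unfold nuMeasure; infer_instance

instance (t : ℝ) : SFinite (muMeasure t) := by
  unfold muMeasure; infer_instance

/-- Integration against `wⁿ` with respect to `ν` gives the Laurent coefficients. -/
theorem integral_conj_zpow_mul {t : ℝ} (ht : 0 < t) (n : ℤ) {F : ℂ → ℂ}
    (hF : DifferentiableOn ℂ F {0}ᶜ)
    (hi : Integrable (fun w => conj (w ^ n) * F w) (nuMeasure t)) :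
    ∫ w, conj (w ^ n) * F w ∂nuMeasure t = (Real.exp (2 * (n : ℝ) ^ 2 * t) : ℂ) *
      Real.circleAverage (fun v => v ^ (-n) * F v) 0 1 := by
  let G : ℂ → ℂ := fun v => v ^ (-n) * F v
  have hG : DifferentiableOn ℂ G {0}ᶜ := by
    refine DifferentiableOn.mul (fun v hv => ?_) hF
    exact (differentiableAt_zpow.2 (Or.inl hv)).differentiableWithinAt
  -- A radial factor times a holomorphic one: averaging over circles replaces `G` by its mean, which
  -- is the same for all radii.
  have e : ∀ w : ℂ, w ≠ 0 → conj (w ^ n) * F w = (((‖w‖ ^ n) ^ 2 : ℝ) : ℂ) * G w := by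
    intro w hw
    simp only [G]
    rw [zpow_neg, ← norm_zpow, Complex.ofReal_pow, ← Complex.mul_conj']
    have := zpow_ne_zero n hw
    field_simp
  have h1 : ∀ᵐ w ∂nuMeasure t, ∫ u : Circle, conj (((u : ℂ) * w) ^ n) * F (u * w) ∂circleMeasure =
      (((‖w‖ ^ n) ^ 2 : ℝ) : ℂ) * Real.circleAverage G 0 1 := by
    filter_upwards [ae_ne_zero_nu t] with w hw
    have h2 : ∀ u : Circle, conj (((u : ℂ) * w) ^ n) * F (u * w) =
        (((‖w‖ ^ n) ^ 2 : ℝ) : ℂ) * G (u * w) := by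
      intro u
      rw [e _ (mul_ne_zero u.coe_ne_zero hw), norm_mul, Circle.norm_coe, one_mul]
    have hm : Measurable fun u : Circle => G (u * w) :=
      (hG.continuousOn.comp_continuous (by fun_prop)
        fun u => mul_ne_zero u.coe_ne_zero hw).measurable
    simp_rw [h2]
    rw [integral_const_mul, integral_circleMeasure_mul G w hm,
      circleAverage_eq_of_differentiableOn_compl_zero hG (norm_pos_iff.2 hw)]
  rw [integral_eq_integral_circle_average (ρ := fun (u : Circle) (w : ℂ) => (u : ℂ) * w)
    (by simp only [Function.uncurry_def]; fun_prop) (measurePreserving_circle_mul_nu t) hi,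
    integral_congr_ae h1, integral_mul_const, integral_complex_ofReal, integral_norm_zpow_nu ht]

/-! ### The test functions in the Bergman space -/

theorem memLp_testHol {t : ℝ} (ht : 0 < t) (i : (Fin 2 → ℂ) × ℤ) :
    MemLp (testHol t i) 2 ((muMeasure t).prod (nuMeasure t)) := by
  have hm : Measurable fun w : ℂ =>
      if w = 0 then 0 else (Real.exp (-(i.2 : ℝ) ^ 2 * t) : ℂ) * w ^ i.2 :=
    Measurable.ite (measurableSet_singleton 0) measurable_const
      ((Measurable.pow_const measurable_id _).const_mul _)
  have hg : Measurable fun z : Fin 2 → ℂ => gaussC (2 * t) fun j => z j - conj (i.1 j) :=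
    ((differentiable_gaussC _).continuous.comp (by fun_prop)).measurable
  have h1 := (memLp_two_iff_integrable_sq_norm hg.aestronglyMeasurable).1 (memLp_gaussC_mu ht i.1)
  have h2 : Integrable (fun w : ℂ => ‖if w = 0 then 0 else
      (Real.exp (-(i.2 : ℝ) ^ 2 * t) : ℂ) * w ^ i.2‖ ^ 2) (nuMeasure t) := by
    refine ((integrable_norm_zpow_nu ht i.2).const_mul
      (Real.exp (-(i.2 : ℝ) ^ 2 * t) ^ 2)).congr ?_
    filter_upwards [ae_ne_zero_nu t] with w hw
    rw [if_neg hw, norm_mul, Complex.norm_real, Real.norm_of_nonneg (Real.exp_pos _).le, norm_zpow,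
      mul_pow]
  rw [memLp_two_iff_integrable_sq_norm]
  · refine (h1.mul_prod h2).congr (Filter.Eventually.of_forall fun p => ?_)
    simp only [testHol]
    rw [norm_mul, mul_pow]
  · exact ((hg.comp measurable_fst).mul (hm.comp measurable_snd)).aestronglyMeasurable

/-- `testHol` as an element of the Bergman space. -/
def testBergman {t : ℝ} (ht : 0 < t) (i : (Fin 2 → ℂ) × ℤ) : BergmanSpace t ht :=
  ⟨testHol t i, by
    rw [← heatTransform_testVec ht]
    exact isHolomorphic_heatTransform ht _, memLp_testHol ht i⟩

theorem testBergman_apply {t : ℝ} (ht : 0 < t) (i : (Fin 2 → ℂ) × ℤ) (p : (Fin 2 → ℂ) × ℂ) :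
    testBergman ht i p = testHol t i p := rfl

theorem BergmanSpace.inner_def {t : ℝ} {ht : 0 < t} (F G : BergmanSpace t ht) :
    inner ℂ F G = ∫ p, conj (F p) * G p ∂(muMeasure t).prod (nuMeasure t) := rfl

/-- The inner products with the test functions are, up to constants, the Laurent coefficients. -/
theorem inner_testBergman {t : ℝ} {ht : 0 < t} (i : (Fin 2 → ℂ) × ℤ) (F : BergmanSpace t ht) :
    inner ℂ (testBergman ht i) F = (Real.exp ((i.2 : ℝ) ^ 2 * t) : ℂ) *
      Real.circleAverage (fun v => v ^ (-i.2) * F (i.1, v)) 0 1 := by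
  set c : ℝ := Real.exp (-(i.2 : ℝ) ^ 2 * t) with hc
  have hc0 : (c : ℂ) ≠ 0 := Complex.ofReal_ne_zero.2 (Real.exp_pos _).ne'
  have hi := BergmanSpace.integrable_inner (testBergman ht i) F
  -- Integrating over `z` reproduces the value `F(q, w)`. Fubini gives the required integrability
  -- for almost every `w`, so no growth estimate for `F` is needed.
  have hinner : ∀ᵐ w ∂nuMeasure t,
      ∫ z, conj (testBergman ht i (z, w)) * F (z, w) ∂muMeasure t =
        c * (conj (w ^ i.2) * F (i.1, w)) := by
    filter_upwards [ae_ne_zero_nu t, hi.prod_left_ae] with w hw hiw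
    have e : ∀ z, conj (testBergman ht i (z, w)) * F (z, w) = (c * conj (w ^ i.2)) *
        (conj (gaussC (2 * t) fun j => z j - conj (i.1 j)) * F (z, w)) := by
      intro z
      rw [testBergman_apply, testHol, if_neg hw, map_mul, map_mul, Complex.conj_ofReal]
      ring
    have hk : (c : ℂ) * conj (w ^ i.2) ≠ 0 :=
      mul_ne_zero hc0 ((map_ne_zero _).2 (zpow_ne_zero _ hw))
    simp_rw [e] at hiw ⊢
    have hiw' := (hiw.const_mul ((c : ℂ) * conj (w ^ i.2))⁻¹)
    simp only [inv_mul_cancel_left₀ hk] at hiw'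
    rw [integral_const_mul, integral_conj_gaussC_mul ht i.1 (F.2.1.1.fst_slice hw) hiw', mul_assoc]
  -- By the previous step this is, up to a constant, an inner Fubini integral, hence integrable.
  have hi2 : Integrable (fun w => conj (w ^ i.2) * F (i.1, w)) (nuMeasure t) := by
    have h1 := (hi.integral_prod_right.congr hinner).const_mul (c : ℂ)⁻¹
    simpa only [inv_mul_cancel_left₀ hc0] using h1
  rw [BergmanSpace.inner_def, integral_prod_symm _ hi, integral_congr_ae hinner, integral_const_mul,
    integral_conj_zpow_mul ht i.2 (F.2.1.1.snd_slice i.1) hi2, ← mul_assoc, hc, ← Complex.ofReal_mul,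
    ← Real.exp_add]
  congr 4
  ring

theorem circleAverage_zpow (n : ℤ) :
    Real.circleAverage (fun v => v ^ n) 0 1 = if n = 0 then 1 else 0 := by
  have h := integral_circleMeasure_mul (fun v => v ^ n) 1
    (by simpa using (Measurable.pow_const (by fun_prop) n))
  simp only [mul_one, norm_one] at h
  rw [← h, integral_circle_zpow]

/-- The heart of the isometry: the factor `e^{n²t}` of the pairing cancels the `e^{-n²t}` in
`testHol`. -/
theorem inner_testBergman_testBergman {t : ℝ} (ht : 0 < t) (i j : (Fin 2 → ℂ) × ℤ) :
    inner ℂ (testBergman ht i) (testBergman ht j) = inner ℂ (testVec ht i) (testVec ht j) := by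
  rw [inner_testBergman, inner_testVec]
  have e : Real.circleAverage (fun v => v ^ (-i.2) * testBergman ht j (i.1, v)) 0 1 =
      Real.circleAverage ((gaussC (2 * t) (fun k => i.1 k - conj (j.1 k)) *
        (Real.exp (-(j.2 : ℝ) ^ 2 * t) : ℂ)) • fun v => v ^ (j.2 - i.2)) 0 1 := by
    refine Real.circleAverage_congr_sphere fun v hv => ?_
    have hv0 : v ≠ 0 := by
      rintro rfl
      simp at hv
    rw [testBergman_apply, testHol, if_neg hv0, Pi.smul_apply, smul_eq_mul, zpow_sub₀ hv0, zpow_neg]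
    ring
  rw [e, Real.circleAverage_smul, circleAverage_zpow]
  by_cases h : i.2 = j.2
  · rw [if_pos (by omega), if_pos h, h, smul_eq_mul, mul_one, mul_left_comm, ← Complex.ofReal_mul,
      ← Real.exp_add]
    simp
  · rw [if_neg (by omega), if_neg h, smul_zero, mul_zero]

/-- A continuous function on the circle whose Fourier coefficients vanish is zero. -/
theorem eq_zero_of_circleAverage_eq_zero {f : ℂ → ℂ} (hf : Continuous fun u : Circle => f u)
    (h : ∀ n : ℤ, Real.circleAverage (fun v => v ^ n * f v) 0 1 = 0) (u : Circle) : f u = 0 := by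
  have hcc : ∀ n : ℤ, Continuous fun u : Circle => (u : ℂ) ^ n := fun n =>
    Continuous.zpow₀ (by fun_prop) n fun u => Or.inl u.coe_ne_zero
  let S : Submonoid (BoundedContinuousFunction Circle ℂ) :=
    { carrier := {χ | ∃ n : ℤ, ∀ u, χ u = (u : ℂ) ^ n}
      one_mem' := ⟨0, fun u => by simp⟩
      mul_mem' := by
        rintro χ η ⟨n, h1⟩ ⟨m, h2⟩
        refine ⟨n + m, fun u => ?_⟩
        rw [BoundedContinuousFunction.mul_apply, h1, h2, zpow_add₀ u.coe_ne_zero] }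
  have hstar : ∀ χ ∈ S, star χ ∈ S := by
    rintro χ ⟨n, h1⟩
    refine ⟨-n, fun u => ?_⟩
    rw [BoundedContinuousFunction.star_apply, h1, RCLike.star_def, map_zpow₀,
      ← Circle.coe_inv_eq_conj, Circle.coe_inv, inv_zpow']
  have hsep : ∀ u v : Circle, u ≠ v → ∃ χ ∈ S, χ u ≠ χ v := fun u v huv =>
    ⟨BoundedContinuousFunction.mkOfCompact ⟨_, hcc 1⟩, ⟨1, fun _ => rfl⟩,
      fun h => huv (Circle.ext (by simpa using h))⟩
  have hi : Integrable (fun u : Circle => f u) circleMeasure := by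
    obtain ⟨C, hC⟩ := isCompact_univ.exists_bound_of_continuousOn hf.continuousOn
    exact Integrable.of_bound hf.aestronglyMeasurable C
      (Filter.Eventually.of_forall fun u => hC u (mem_univ u))
  have h0 := ae_eq_zero_of_integral_mul_eq_zero hi S hstar hsep (by
    rintro χ ⟨n, hχ⟩
    simp_rw [hχ]
    have h1 := integral_circleMeasure_mul (fun v => v ^ n * f v) 1
      (by simp only [mul_one]; exact ((hcc n).mul hf).measurable)
    simp only [mul_one, norm_one] at h1
    rw [h1, h n])
  have h2 : circleMeasure {u : Circle | f u ≠ 0} = 0 := h0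
  have hopen : IsOpen {u : Circle | f u ≠ 0} := isOpen_ne.preimage hf
  rw [circleMeasure, Measure.smul_apply, smul_eq_mul, mul_eq_zero,
    Measure.map_apply (by fun_prop) hopen.measurableSet] at h2
  have hpi := Real.pi_pos
  have h3 := h2.resolve_left (ENNReal.ofReal_pos.2 (by positivity)).ne'
  -- Continuity upgrades vanishing almost everywhere to vanishing everywhere on the interval, which
  -- contains `arg u`.
  have h4 : (fun θ : ℝ => f (Circle.exp θ)) =ᵐ[volume.restrict (Ioc (-Real.pi) Real.pi)]
      fun _ => 0 := h3
  have h5 := Measure.eqOn_Ioc_of_ae_eq (μ := volume) h4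
    (hf.comp (by fun_prop)).continuousOn continuousOn_const
  have h6 := h5 (Complex.arg_mem_Ioc (u : ℂ))
  simpa using h6

/-- The pairings are nonzero multiples of the Fourier coefficients of `F(q, ·)` on the unit circle,
so `F` vanishes on `ℂ² × S¹`, which contains the uniqueness set `M(2)`. -/
theorem eq_zero_of_inner_testBergman_eq_zero {t : ℝ} {ht : 0 < t} (F : BergmanSpace t ht)
    (hF : ∀ i, inner ℂ (testBergman ht i) F = 0) : F = 0 := by
  have h1 : ∀ (q : Fin 2 → ℂ) (u : Circle), F (q, u) = 0 := by
    intro q u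
    refine eq_zero_of_circleAverage_eq_zero (f := fun v => F (q, v)) ?_ (fun n => ?_) u
    · exact (F.2.1.1.snd_slice q).continuousOn.comp_continuous (by fun_prop) fun u => u.coe_ne_zero
    · have h := hF (q, -n)
      rw [inner_testBergman, mul_eq_zero, neg_neg] at h
      exact h.resolve_left (Complex.ofReal_ne_zero.2 (Real.exp_pos _).ne')
  have h2 := eqOn_complexM2_of_eq_on_M2 F.2.1.1 fun g => h1 _ _
  refine Subtype.ext (funext fun p => ?_)
  by_cases hp : p ∈ complexM2
  · exact h2 p hp
  · exact F.2.1.2 p hp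

/-! ### Unitarity of the heat transform -/

/-- Connects the norm built from the inner product with the one to which Fatou's lemma applies. -/
theorem BergmanSpace.eLpNorm_eq {t : ℝ} {ht : 0 < t} (F : BergmanSpace t ht) :
    eLpNorm (fun p => F p) 2 ((muMeasure t).prod (nuMeasure t)) = ENNReal.ofReal ‖F‖ := by
  have h1 : ‖F‖ = ‖F.2.2.toLp _‖ := by
    rw [← sq_eq_sq₀ (norm_nonneg _) (norm_nonneg _), ← inner_self_eq_norm_sq (𝕜 := ℂ),
      ← inner_self_eq_norm_sq (𝕜 := ℂ), BergmanSpace.inner_def, L2.inner_def]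
    congr 1
    refine integral_congr_ae ?_
    filter_upwards [F.2.2.coeFn_toLp] with p hp
    rw [hp, RCLike.inner_apply, mul_comm]
  rw [h1, Lp.norm_toLp, ENNReal.ofReal_toReal F.2.2.2.ne]

theorem dense_span_testVec {t : ℝ} (ht : 0 < t) :
    DenseRange (Finsupp.linearCombination ℂ (testVec ht)) := by
  have h : (LinearMap.range (Finsupp.linearCombination ℂ (testVec ht))).topologicalClosure = ⊤ := by
    rw [Submodule.topologicalClosure_eq_top_iff, Submodule.eq_bot_iff]
    intro f hf
    refine eq_zero_of_inner_testVec_eq_zero ht f fun i => ?_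
    exact (Submodule.mem_orthogonal _ _).1 hf _ ⟨Finsupp.single i 1, by simp⟩
  have h2 := Submodule.dense_iff_topologicalClosure_eq_top.2 h
  rwa [LinearMap.coe_range] at h2

theorem heatTransform_add {t : ℝ} (ht : 0 < t) (f g : Lp ℂ 2 (volume : Measure M2)) :
    heatTransform t (f + g) = heatTransform t f + heatTransform t g := by
  funext p
  rw [Pi.add_apply]
  simp only [heatTransform_eq_inner ht, inner_add_right]

theorem heatTransform_smul {t : ℝ} (ht : 0 < t) (c : ℂ) (f : Lp ℂ 2 (volume : Measure M2)) :
    heatTransform t (c • f) = c • heatTransform t f := by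
  funext p
  rw [Pi.smul_apply]
  simp only [heatTransform_eq_inner ht, inner_smul_right, smul_eq_mul]

theorem heatTransform_linearCombination {t : ℝ} (ht : 0 < t) (c : (Fin 2 → ℂ) × ℤ →₀ ℂ) :
    heatTransform t (Finsupp.linearCombination ℂ (testVec ht) c) =
      fun p => Finsupp.linearCombination ℂ (testBergman ht) c p := by
  induction c using Finsupp.induction_linear with
  | zero =>
    funext p
    rw [map_zero, map_zero, heatTransform_eq_inner ht, inner_zero_right]
    rfl
  | add c d hc hd =>
    rw [map_add, map_add, heatTransform_add ht, hc, hd]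
    rfl
  | single i a =>
    rw [Finsupp.linearCombination_single, Finsupp.linearCombination_single, heatTransform_smul ht,
      heatTransform_testVec]
    rfl

theorem norm_linearCombination_testBergman {t : ℝ} (ht : 0 < t) (c : (Fin 2 → ℂ) × ℤ →₀ ℂ) :
    ‖Finsupp.linearCombination ℂ (testBergman ht) c‖ =
      ‖Finsupp.linearCombination ℂ (testVec ht) c‖ := by
  rw [← sq_eq_sq₀ (norm_nonneg _) (norm_nonneg _), ← inner_self_eq_norm_sq (𝕜 := ℂ),
    ← inner_self_eq_norm_sq (𝕜 := ℂ)]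
  simp only [Finsupp.linearCombination_apply, Finsupp.sum_inner, Finsupp.inner_sum,
    inner_smul_left, inner_smul_right, inner_testBergman_testBergman]

/-- Approximation by combinations of test functions, where equality holds. The transforms converge
pointwise, and Fatou's lemma gives the inequality in the limit. -/
theorem eLpNorm_heatTransform_le {t : ℝ} (ht : 0 < t) (f : Lp ℂ 2 (volume : Measure M2)) :
    eLpNorm (heatTransform t f) 2 ((muMeasure t).prod (nuMeasure t)) ≤ ENNReal.ofReal ‖f‖ := by
  obtain ⟨s, hs, hlim⟩ := mem_closure_iff_seq_limit.1 (dense_span_testVec ht f)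
  choose c hc using hs
  have hm : ∀ n, eLpNorm (heatTransform t (s n)) 2 ((muMeasure t).prod (nuMeasure t)) =
      ENNReal.ofReal ‖s n‖ := by
    intro n
    rw [← hc n, heatTransform_linearCombination, BergmanSpace.eLpNorm_eq,
      norm_linearCombination_testBergman]
  have hae : ∀ n, AEStronglyMeasurable (heatTransform t (s n))
      ((muMeasure t).prod (nuMeasure t)) := by
    intro n
    rw [← hc n, heatTransform_linearCombination]
    exact (Finsupp.linearCombination ℂ (testBergman ht) (c n)).2.2.1
  have hpt : ∀ p, Filter.Tendsto (fun n => heatTransform t (s n) p) Filter.atTop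
      (nhds (heatTransform t f p)) := by
    intro p
    simp only [heatTransform_eq_inner ht]
    exact tendsto_const_nhds.inner hlim
  refine (Lp.eLpNorm_lim_le_liminf_eLpNorm hae _ (Filter.Eventually.of_forall hpt)).trans ?_
  simp_rw [hm]
  exact ((ENNReal.continuous_ofReal.tendsto _).comp hlim.norm).liminf_eq.le

theorem memLp_heatTransform {t : ℝ} (ht : 0 < t) (f : Lp ℂ 2 (volume : Measure M2)) :
    MemLp (heatTransform t f) 2 ((muMeasure t).prod (nuMeasure t)) := by
  refine ⟨?_, (eLpNorm_heatTransform_le ht f).trans_lt ENNReal.ofReal_lt_top⟩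
  obtain ⟨s, hs, hlim⟩ := mem_closure_iff_seq_limit.1 (dense_span_testVec ht f)
  choose c hc using hs
  refine aestronglyMeasurable_of_tendsto_ae Filter.atTop (f := fun n => heatTransform t (s n))
    (fun n => ?_) (Filter.Eventually.of_forall fun p => ?_)
  · rw [← hc n, heatTransform_linearCombination]
    exact (Finsupp.linearCombination ℂ (testBergman ht) (c n)).2.2.1
  · simp only [heatTransform_eq_inner ht]
    exact tendsto_const_nhds.inner hlim

/-- The heat transform as a linear map into the Bergman space. -/
def heatTransformₗ {t : ℝ} (ht : 0 < t) :
    Lp ℂ 2 (volume : Measure M2) →ₗ[ℂ] BergmanSpace t ht where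
  toFun f := ⟨heatTransform t f, isHolomorphic_heatTransform ht f, memLp_heatTransform ht f⟩
  map_add' f g := Subtype.ext (heatTransform_add ht f g)
  map_smul' c f := Subtype.ext (heatTransform_smul ht c f)

theorem heatTransformₗ_linearCombination {t : ℝ} (ht : 0 < t) (c : (Fin 2 → ℂ) × ℤ →₀ ℂ) :
    heatTransformₗ ht (Finsupp.linearCombination ℂ (testVec ht) c) =
      Finsupp.linearCombination ℂ (testBergman ht) c :=
  Subtype.ext (heatTransform_linearCombination ht c)

/-- The inequality makes the map continuous, and the equality then passes from the dense span to the
whole space. -/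
theorem norm_heatTransformₗ {t : ℝ} (ht : 0 < t) (f : Lp ℂ 2 (volume : Measure M2)) :
    ‖heatTransformₗ ht f‖ = ‖f‖ := by
  have hle : ∀ f, ‖heatTransformₗ ht f‖ ≤ ‖f‖ := by
    intro f
    have h := eLpNorm_heatTransform_le ht f
    have h2 := BergmanSpace.eLpNorm_eq (heatTransformₗ ht f)
    have h3 : (fun p => heatTransformₗ ht f p) = heatTransform t f := rfl
    rw [h3] at h2
    rw [h2] at h
    exact (ENNReal.ofReal_le_ofReal_iff (norm_nonneg _)).1 h
  have hcont : Continuous (heatTransformₗ ht) :=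
    AddMonoidHomClass.continuous_of_bound (heatTransformₗ ht) 1 fun f => by simpa using hle f
  refine congrFun ((dense_span_testVec ht).equalizer hcont.norm continuous_norm ?_) f
  funext c
  simp only [Function.comp]
  rw [heatTransformₗ_linearCombination, norm_linearCombination_testBergman]

/-- The heat transform as a linear isometry. -/
def heatTransformₗᵢ {t : ℝ} (ht : 0 < t) :
    Lp ℂ 2 (volume : Measure M2) →ₗᵢ[ℂ] BergmanSpace t ht :=
  ⟨heatTransformₗ ht, norm_heatTransformₗ ht⟩

/-- The range is complete as an isometric image of `L²(M(2))`, so completeness of the Bergman space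
is not needed beforehand; the range contains the total family `testBergman`. -/
theorem surjective_heatTransformₗᵢ {t : ℝ} (ht : 0 < t) :
    Function.Surjective (heatTransformₗᵢ ht) := by
  let K := LinearMap.range (heatTransformₗᵢ ht).toLinearMap
  have hK : IsComplete (K : Set (BergmanSpace t ht)) := by
    have h1 : (K : Set (BergmanSpace t ht)) = range (heatTransformₗᵢ ht) := by
      ext; simp [K]
    rw [h1]
    exact (heatTransformₗᵢ ht).isometry.isUniformInducing.isComplete_range
  have : CompleteSpace K := hK.completeSpace_coe
  have hbot : Kᗮ = ⊥ := by
    rw [Submodule.eq_bot_iff]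
    intro F hF
    refine eq_zero_of_inner_testBergman_eq_zero F fun i => ?_
    exact (Submodule.mem_orthogonal _ _).1 hF _
      ⟨testVec ht i, Subtype.ext (heatTransform_testVec ht i)⟩
  exact LinearMap.range_eq_top.1 (Submodule.orthogonal_eq_bot_iff.1 hbot)

end

theorem mainTheorem1 (t : ℝ) (ht : 0 < t) :
    (∀ f : Lp ℂ 2 (volume : Measure M2),
      (∀ g : M2, Integrable fun h : M2 => f h * M2.heatKernel t (h⁻¹ * g)) ∧
      ∃! F : (Fin 2 → ℂ) × ℂ → ℂ, IsHolomorphicOnComplexM2 F ∧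
        ∀ g : M2, F g.toComplex = M2.conv f (M2.heatKernel t) g) ∧
    ∃ U : Lp ℂ 2 (volume : Measure M2) ≃ₗᵢ[ℂ] BergmanSpace t ht,
      ∀ (f : Lp ℂ 2 (volume : Measure M2)) (g : M2),
        U f g.toComplex = M2.conv f (M2.heatKernel t) g := by
  refine ⟨fun f => ⟨fun g => ?_, heatTransform t f,
    ⟨isHolomorphic_heatTransform ht f, heatTransform_toComplex t f⟩, ?_⟩,
    LinearIsometryEquiv.ofSurjective (heatTransformₗᵢ ht) (surjective_heatTransformₗᵢ ht),
    fun f g => heatTransform_toComplex t f g⟩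
  · simp only [heatKernel_inv_mul]
    exact integrable_mul_heatKernelC ht f _
  · rintro F ⟨hF, hFg⟩
    have hH := isHolomorphic_heatTransform ht f
    funext p
    by_cases hp : p ∈ complexM2
    · have h := eqOn_complexM2_of_eq_on_M2 (hF.1.sub hH.1) (fun g => by
        rw [Pi.sub_apply, hFg, heatTransform_toComplex, sub_self]) p hp
      exact sub_eq_zero.1 h
    · rw [hF.2 p hp, hH.2 p hp]
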